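/- Let $p$ be a prime and let $G$ be a (one-dimensional commutative) formal group of height one over $\mathbb{Z}_p$ with a coordinate $t$; let $F$ be the induced formal group law. Let $F[p]$ be the set of $p$-torsion points of $F$ in the open unit disc of $\mathbb{C}_p$, and suppose that $t$ satisfies the Ando condition $$\prod_{c \in F[p]} (t +_F c) = [p]_F(t).$$ Let $D_F = F_2(t,0)\frac{d}{dt}$ be the invariant derivation ($F_2$ is the partial derivative of $F(x,y)$ in the second variable), let $\beta^k f = (D_F^k f)(0)$, let $\log_F(t) = t + \cdots \in \mathbb{Q}_p[[t]]$ be the strict logarithm of $F$, and put $$B^k(G,t) = \beta^k\left(\log \frac{\log_F t}{t}\right) \in \mathbb{Q}_p .$$ Let $T_pG^\vee$ be the group, under multiplication, of the power series $g \in \mathbb{Z}_p[[t]]$ with $g(0)=1$ and $g(x+_F y) = g(x)g(y)$, with the topology of coefficientwise convergence, and let $(T_pG^\vee)^\times$ be the complement of the subgroup of $p$-th powers (that is, of $pT_pG^\vee$ in additive notation). Then: (1) $g \mapsto \beta^1(g)$ is an isomorphism of topological groups $T_pG^\vee \cong \mathbb{Z}_p$, and it restricts to a homeomorphism $(T_pG^\vee)^\times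 \cong \mathbb{Z}_p^\times$. (2) For every $a \in \mathbb{Z}_p^\times \setminus \{\pm 1\}$ there is a measure $\mu$ on $G^\times$, that is, a continuous $\mathbb{Z}_p$-linear functional on the continuous functions $(T_pG^\vee)^\times \to \mathbb{Z}_p$, whose moments are $$\int \beta^k(g)\, d\mu(g) = \int x^k\, d\mu(x) = B^k(G,t)\,(1-a^k)\,(1-p^{k-1}) \qquad \text{for all } k \ge 1,$$ where in the second integral $x = \beta^1(g) \in \mathbb{Z}_p^\times$ under the identification in (1). -/

import Mathlib

open scoped PowerSeries.WithPiTopology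

noncomputable section

namespace FormalGroup

section General

variable {R : Type*} [CommRing R] (F : FormalGroup R)

/-- The coordinate `t`, as a point of `F` with values in `R⟦t⟧`. -/
def coord : F.Point Unit :=
  ⟨PowerSeries.X, PowerSeries.HasSubst.X'⟩

/-- The `n`-series `[n]_F(t)`: the coordinate `t` added to itself `n` times in the formal group law
`F`, computed in the additive monoid of points of `F` with values in `R⟦t⟧`. -/
def nSeries (n : ℕ) : PowerSeries R :=
  (n • F.coord).val

/-- The power series `F_2(t, 0)`, where `F_2` is the partial derivative of `F(x, y)` with respect to
the second variable. -/
def partialTwo : PowerSeries R :=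
  (MvPowerSeries.pderiv R 1 F.toPowerSeries).subst
    ![(PowerSeries.X : PowerSeries R), (0 : PowerSeries R)]

/-- The invariant derivation `D_F = F_2(t, 0) d/dt` on `R⟦t⟧`. -/
def invDeriv (f : PowerSeries R) : PowerSeries R :=
  F.partialTwo * PowerSeries.derivative R f

/-- `β^k f = (D_F ^ k f)(0)`: apply the invariant derivation `k` times and evaluate at the
identity of the formal group. -/
def beta (k : ℕ) (f : PowerSeries R) : R :=
  PowerSeries.constantCoeff (F.invDeriv^[k] f)

theorem continuous_beta [TopologicalSpace R] [IsTopologicalRing R] (k : ℕ) :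
    Continuous (F.beta k) := by
  have hD : Continuous F.invDeriv := by
    have hd : Continuous (fun f : PowerSeries R => PowerSeries.derivative R f) := by
      refine continuous_pi fun d => ?_
      have hc : ∀ f : PowerSeries R, PowerSeries.derivative R f d =
          PowerSeries.coeff (d () + 1) f * ((d () : R) + 1) := by
        intro f
        rw [← PowerSeries.coeff_derivative]
        have hs : d = Finsupp.single () (d ()) :=
          Finsupp.ext fun u => by cases u; exact Finsupp.single_eq_same.symm
        exact congrArg (PowerSeries.derivative R f) hs
      simp only [hc]
      exact (PowerSeries.WithPiTopology.continuous_coeff R _).mul continuous_const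
    exact continuous_const.mul hd
  exact (PowerSeries.WithPiTopology.continuous_constantCoeff R).comp (hD.iterate k)

/-- The characters of the formal group over `R`: power series `g(t)` with `g(0) = 1` and
`g(x +_F y) = g(x) g(y)`, i.e. the homomorphisms from the formal group to the multiplicative group.
The group law is multiplication of power series.  This is the Tate module `T_p G^∨` of the dual of
a formal group `G` of height one, with coordinate `t` and group law `F`.  As a subtype of
`R⟦t⟧` it carries the topology of coefficientwise convergence. -/
def dualTate : Submonoid (PowerSeries R) where
  carrier := {g | PowerSeries.constantCoeff g = 1 ∧
    PowerSeries.subst F.toPowerSeries g =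
      PowerSeries.subst (MvPowerSeries.X 0 : MvPowerSeries (Fin 2) R) g *
        PowerSeries.subst (MvPowerSeries.X 1 : MvPowerSeries (Fin 2) R) g}
  one_mem' := by
    refine ⟨map_one _, ?_⟩
    have hF : PowerSeries.HasSubst F.toPowerSeries :=
      PowerSeries.HasSubst.of_constantCoeff_zero F.zero_constantCoeff
    have h0 : PowerSeries.HasSubst (MvPowerSeries.X 0 : MvPowerSeries (Fin 2) R) :=
      PowerSeries.HasSubst.X 0
    have h1 : PowerSeries.HasSubst (MvPowerSeries.X 1 : MvPowerSeries (Fin 2) R) :=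
      PowerSeries.HasSubst.X 1
    rw [← PowerSeries.coe_substAlgHom hF, ← PowerSeries.coe_substAlgHom h0,
      ← PowerSeries.coe_substAlgHom h1]
    simp
  mul_mem' := by
    rintro f g ⟨hf0, hf⟩ ⟨hg0, hg⟩
    refine ⟨by rw [map_mul, hf0, hg0, one_mul], ?_⟩
    have hF : PowerSeries.HasSubst F.toPowerSeries :=
      PowerSeries.HasSubst.of_constantCoeff_zero F.zero_constantCoeff
    have h0 : PowerSeries.HasSubst (MvPowerSeries.X 0 : MvPowerSeries (Fin 2) R) :=
      PowerSeries.HasSubst.X 0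
    have h1 : PowerSeries.HasSubst (MvPowerSeries.X 1 : MvPowerSeries (Fin 2) R) :=
      PowerSeries.HasSubst.X 1
    rw [PowerSeries.subst_mul hF, PowerSeries.subst_mul h0, PowerSeries.subst_mul h1, hf, hg]
    ring

/-- `(T_p G^∨)^×`, the complement of `p T_p G^∨` in `T_p G^∨`.  The group is written
multiplicatively, so multiplication by `p` is the `p`-th power map. -/
def dualTateUnits (p : ℕ) : Set F.dualTate :=
  {g | ¬ ∃ h : F.dualTate, h ^ p = g}

/-- The pairing `g ↦ ⟨D_F ^ k, g⟩ = (D_F ^ k g)(0)`, as a continuous function on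
`(T_p G^∨)^×`. -/
def pairing [TopologicalSpace R] [IsTopologicalRing R] (p k : ℕ) : C(F.dualTateUnits p, R) where
  toFun g := F.beta k ((g : F.dualTate) : PowerSeries R)
  continuous_toFun :=
    (F.continuous_beta k).comp (continuous_subtype_val.comp continuous_subtype_val)

end General

section Rational

variable {K : Type*} [Field K] (F : FormalGroup K)

/-- The strict logarithm `log_F(t) = ∫ dt / F_2(t, 0) = t + ⋯` of a formal group law over a field of
characteristic zero: the integral, with constant term zero, of the normalized invariant
differential. -/
def formalLog : PowerSeries K :=
  PowerSeries.mk fun n => if n = 0 then 0 else PowerSeries.coeff (n - 1) (F.partialTwo⁻¹) / (n : K)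

/-- The power series `log_F(t) / t = 1 + ⋯`. -/
def formalLogDivX : PowerSeries K :=
  PowerSeries.mk fun n => PowerSeries.coeff (n + 1) F.formalLog

end Rational

section Padic

variable {p : ℕ} [Fact p.Prime] (F : FormalGroup ℤ_[p])

/-- The formal group law has height one: modulo `p`, the series `[p]_F(t)` is
`u t ^ p + ⋯` with `u ≠ 0`. -/
def HasHeightOne : Prop :=
  (PowerSeries.map (PadicInt.toZMod (p := p)) (F.nSeries p)).order = (p : ℕ∞)

/-- The inclusion of `ℤ_p` in `ℂ_p`. -/
def toCp (p : ℕ) [Fact p.Prime] : ℤ_[p] →+* ℂ_[p] :=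
  (algebraMap ℚ_[p] ℂ_[p]).comp PadicInt.Coe.ringHom

/-- `F[p]`: the points `c` of the open unit disc of `ℂ_p` with `[p]_F(c) = 0`. -/
def torsion : Set ℂ_[p] :=
  {c | ‖c‖ < 1 ∧ ∑' n : ℕ, toCp p (PowerSeries.coeff n (F.nSeries p)) * c ^ n = 0}

/-- The power series `t +_F c = F(t, c)` in `ℂ_p⟦t⟧`, for `c` in the open unit disc of `ℂ_p`. The
coefficient of `t ^ i` is the sum over `j` of the coefficient of `x ^ i y ^ j` in `F` times
`c ^ j`. -/
def translate (c : ℂ_[p]) : PowerSeries ℂ_[p] :=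
  PowerSeries.mk fun i => ∑' j : ℕ,
    toCp p (MvPowerSeries.coeff (Finsupp.single 0 i + Finsupp.single 1 j) F.toPowerSeries) * c ^ j

/-- The Ando condition: Lubin's isogeny `∏_{c ∈ F[p]} (t +_F c)` coincides with `[p]_F(t)`. -/
def AndoCondition : Prop :=
  ∏ᶠ c ∈ F.torsion, F.translate c = PowerSeries.map (toCp p) (F.nSeries p)

/-- The Bernoulli number `B^k(G, t) = β^k (log (log_F(t) / t))` in `ℚ_p` of the formal group `G`
over `ℤ_p` with coordinate `t` and formal group law `F`. -/
def bernoulliNumber (k : ℕ) : ℚ_[p] :=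
  (F.map PadicInt.Coe.ringHom).beta k
    (PowerSeries.logOf (F.map (PadicInt.Coe.ringHom (p := p))).formalLogDivX)

end Padic

end FormalGroup

/-- The function `x ↦ x ^ k` on `ℤ_p^×`. -/
def padicUnitPow (p : ℕ) [Fact p.Prime] (k : ℕ) : C(ℤ_[p]ˣ, ℤ_[p]) where
  toFun x := (x : ℤ_[p]) ^ k
  continuous_toFun := Units.continuous_val.pow k

end

/-!
The proof reduces everything to the multiplicative group, where measures are power series.

*The character.* Modulo the maximal ideal of the integers of `ℂ_p` every translate `t +_F c` is
`t`, so the Ando condition and the height force `#F[p] = p` and `[p]_F(t) ≡ t ^ p` modulo `p`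
(`AndoCondition.exists_finset`). The series `g = exp(log_F(t))` takes `[p]_F(t)` to its `p`-th
power, and since `[p]_F` lifts Frobenius it is integral by Dwork's lemma
(`exists_invDeriv_eq_self`). The characters of `F` are the normalized eigenvectors of the
invariant derivation (`invDeriv_eq_of_mem_dualTate`, `mem_dualTate_of_invDeriv_eq`), the
eigenvalue being `β^1`; hence they are the powers `g ^ a` with `a ∈ ℤ_p`, and `β^1` is a
topological isomorphism from the group of characters to `ℤ_p` (`dualTateHomeomorph`), under which
`β^k` becomes `x ^ k`.

*Transport to the multiplicative group.* The series `T = g(t) - 1` is a new coordinate. Write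
`t = τ(T)` (`IsInverseParam`). The invariant derivation becomes `D = (1 + T) d/dT`, and
multiplication by `a` becomes `[a](T) = (1 + T) ^ a - 1`. The points of `F[p]` go to the `ζ - 1`
with `ζ ^ p = 1`, translation by a point becomes `T ↦ ζ (1 + T) - 1`, and the Ando condition
becomes the norm relation `∏_ζ τ(ζ (1 + T) - 1) = τ((1 + T) ^ p - 1)`
(`AndoCondition.prod_twist`).

*The measure.* Since `ζ ↦ ζ ^ a` permutes the roots of unity, `τ ∘ [a]` satisfies the same
relation, and so does `q = (τ ∘ [a]) / (a τ)` up to a constant. The logarithmic derivative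
`H = D q / q` therefore satisfies the trace relation `∑_ζ H(ζ (1 + T) - 1) = p H((1 + T) ^ p - 1)`
(`sum_twist_eq_of_prod_twist_eq`). Let `m` be the measure on `ℤ_p` with Mahler transform `H`, so
that `∫ x ^ j dm = (D ^ j H)(0)`. By orthogonality of characters of `ℤ/p` the trace relation says
that the part of this integral over `p ℤ_p` is `p ^ j (D ^ j H)(0)`
(`mahlerFunctional_pow_mul_indicatorMul`). The restriction of `m` to `ℤ_p^×`, multiplied by `x⁻¹`,
has `k`-th moment `(1 - p ^ (k - 1)) (D ^ (k - 1) H)(0)`.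

*The moments.* Let `L = log_F(t) / t`. As `log_F ∘ [a] = a log_F`, one has `q = L / (L ∘ [a])`,
and `H = ℓ - a ℓ ∘ [a]`, where `ℓ = D L / L` (`logDeriv_eq`). Hence
`(D ^ (k - 1) H)(0) = (1 - a ^ k) (D ^ (k - 1) ℓ)(0) = (1 - a ^ k) β^k(log L)`.
-/

/-! ### The invariant derivation -/

namespace MvPowerSeries

variable {σ τ R : Type*} [CommRing R]

open scoped MvPowerSeries.WithPiTopology in
theorem continuous_pderiv [TopologicalSpace R] [IsTopologicalSemiring R] (i : σ) :
    Continuous (pderiv R i : MvPowerSeries σ R → MvPowerSeries σ R) := by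
  refine continuous_pi fun d => ?_
  have : (fun f : MvPowerSeries σ R => pderiv R i f d) =
      fun f => coeff (d + Finsupp.single i 1) f * ((d i : R) + 1) :=
    funext fun f => coeff_pderiv f d
  rw [this]
  exact ((WithPiTopology.continuous_coeff R _).mul continuous_const)

open scoped MvPowerSeries.WithPiTopology in
/-- The chain rule for the substitution of power series into a power series. -/
theorem pderiv_subst [Fintype σ] {a : σ → MvPowerSeries τ R} (ha : HasSubst a)
    (f : MvPowerSeries σ R) (i : τ) :
    pderiv R i (subst a f) = ∑ s, subst a (pderiv R s f) * pderiv R i (a s) := by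
  classical
  let : UniformSpace R := ⊥
  have : DiscreteUniformity R := ⟨rfl⟩
  have hs := continuous_subst (R := R) ha
  suffices h : (fun f => pderiv R i (subst a f)) =
      fun f => ∑ s, subst a (pderiv R s f) * pderiv R i (a s) from congrFun h f
  refine DenseRange.equalizer WithPiTopology.denseRange_toMvPowerSeries
    ((continuous_pderiv i).comp hs) (continuous_finsetSum _ fun s _ =>
      (hs.comp (continuous_pderiv s)).mul continuous_const) (funext fun q => ?_)
  simp only [Function.comp_apply, pderiv_coe, subst_coe]
  induction q using MvPolynomial.induction_on with
  | C r => simp [MvPowerSeries.algebraMap_apply]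
  | add q r hq hr => simp [hq, hr, add_mul, Finset.sum_add_distrib]
  | mul_X q n hq =>
    simp only [map_mul, MvPolynomial.aeval_X, Derivation.leibniz, smul_eq_mul, hq, map_add,
      MvPolynomial.pderiv_X, add_mul, Finset.sum_add_distrib, Finset.mul_sum]
    congr 1
    · rw [Finset.sum_eq_single n]
      · simp
      · intro b _ hb
        simp [hb.symm]
      · simp
    · exact Finset.sum_congr rfl fun _ _ => by ring

end MvPowerSeries

namespace PowerSeries

variable {τ R : Type*} [CommRing R]

theorem pderiv_subst {a : MvPowerSeries τ R} (ha : HasSubst a) (f : PowerSeries R) (i : τ) :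
    MvPowerSeries.pderiv R i (subst a f) =
      subst a (derivative R f) * MvPowerSeries.pderiv R i a := by
  have := MvPowerSeries.pderiv_subst ha.const f i
  simpa [subst, derivative] using this

end PowerSeries

namespace FormalGroup

section General

variable {R : Type*} [CommRing R] (F : FormalGroup R) {σ : Type*}

open MvPowerSeries (X)

theorem hasSubst_pair {f g : MvPowerSeries σ R} (hf : MvPowerSeries.constantCoeff f = 0)
    (hg : MvPowerSeries.constantCoeff g = 0) : MvPowerSeries.HasSubst ![f, g] :=
  MvPowerSeries.hasSubst_of_constantCoeff_zero (by simp [Fin.forall_fin_two, hf, hg])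

theorem constantCoeff_subst_pair {f g : MvPowerSeries σ R}
    (hf : MvPowerSeries.constantCoeff f = 0) (hg : MvPowerSeries.constantCoeff g = 0) :
    MvPowerSeries.constantCoeff (F.toPowerSeries.subst ![f, g]) = 0 :=
  MvPowerSeries.constantCoeff_subst_eq_zero (hasSubst_pair hf hg)
    (by simp [Fin.forall_fin_two, hf, hg]) F.zero_constantCoeff

theorem subst_partialTwo {f : MvPowerSeries σ R} (hf : MvPowerSeries.constantCoeff f = 0) :
    F.partialTwo.subst f = (MvPowerSeries.pderiv R 1 F.toPowerSeries).subst ![f, 0] := by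
  have h := PowerSeries.HasSubst.of_constantCoeff_zero hf
  rw [partialTwo, PowerSeries.subst,
    MvPowerSeries.subst_comp_subst_apply (hasSubst_pair (by simp [PowerSeries.X]) (map_zero _))
      h.const]
  congr 1
  funext s
  fin_cases s
  · exact PowerSeries.subst_X h
  · exact map_zero (MvPowerSeries.substAlgHom (R := R) h.const) ▸
      (MvPowerSeries.substAlgHom_apply h.const _).symm

theorem constantCoeff_partialTwo : PowerSeries.constantCoeff F.partialTwo = 1 := by
  have h := (MvPowerSeries.coeff_pderiv (i := 1) F.toPowerSeries 0)
  simp only [_root_.zero_add, F.lin_coeff_Y] at h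
  rw [partialTwo, PowerSeries.constantCoeff,
    MvPowerSeries.constantCoeff_subst (hasSubst_pair (by simp [PowerSeries.X])
      (map_zero _)), finsum_eq_single _ 0]
  · simp [h]
  · intro d hd
    have : d 0 ≠ 0 ∨ d 1 ≠ 0 := by
      by_contra! h
      exact hd (Finsupp.ext fun i => by fin_cases i <;> simp [h])
    rw [Finsupp.prod_fintype _ _ (by simp)]
    rcases this with h | h <;> simp [h, PowerSeries.X]

theorem isUnit_partialTwo : IsUnit F.partialTwo :=
  PowerSeries.isUnit_iff_constantCoeff.2 (by simp [constantCoeff_partialTwo])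

/-- Invariance of the derivation: `P(F(x, y)) = F_2(x, y) P(y)`, where `P(t) = F_2(t, 0)`. It is
the derivative at `z = 0` of the associativity law `F(F(x, y), z) = F(x, F(y, z))`. -/
theorem subst_partialTwo_add :
    F.partialTwo.subst F.toPowerSeries =
      MvPowerSeries.pderiv R 1 F.toPowerSeries *
        F.partialTwo.subst (X 1 : MvPowerSeries (Fin 2) R) := by
  have hl := MvPowerSeries.HasSubst.cons_subst_zero_left (0 : Fin 3) 1 2 F.zero_constantCoeff
  have hr := MvPowerSeries.HasSubst.cons_subst_zero_right (0 : Fin 3) 1 2 F.zero_constantCoeff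
  have h := congrArg (MvPowerSeries.pderiv R 2) F.assoc
  rw [MvPowerSeries.pderiv_subst hl, MvPowerSeries.pderiv_subst hr] at h
  simp only [Fin.sum_univ_two, Matrix.cons_val_zero, Matrix.cons_val_one,
    MvPowerSeries.pderiv_subst MvPowerSeries.HasSubst.X_X, MvPowerSeries.pderiv_X_self,
    MvPowerSeries.pderiv_X_of_ne (show (0 : Fin 3) ≠ 2 by decide),
    MvPowerSeries.pderiv_X_of_ne (show (1 : Fin 3) ≠ 2 by decide), mul_zero, _root_.add_zero,
    _root_.zero_add, mul_one] at h
  have hb : MvPowerSeries.HasSubst ![X 0, X 1, (0 : MvPowerSeries (Fin 2) R)] :=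
    MvPowerSeries.hasSubst_of_constantCoeff_zero (by simp [Fin.forall_fin_succ])
  replace h := congrArg (MvPowerSeries.subst ![X 0, X 1, (0 : MvPowerSeries (Fin 2) R)]) h
  have h01 : (fun s => MvPowerSeries.subst ![X 0, X 1, (0 : MvPowerSeries (Fin 2) R)]
      (![X 0, X 1] s : MvPowerSeries (Fin 3) R)) = X := by
    funext s
    fin_cases s <;> simp [MvPowerSeries.subst_X hb]
  have h12 : (fun s => MvPowerSeries.subst ![X 0, X 1, (0 : MvPowerSeries (Fin 2) R)]
      (![X 1, X 2] s : MvPowerSeries (Fin 3) R)) = ![X 1, 0] := by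
    funext s
    fin_cases s <;> simp [MvPowerSeries.subst_X hb]
  rw [MvPowerSeries.subst_mul hb, MvPowerSeries.subst_comp_subst_apply hl hb,
    MvPowerSeries.subst_comp_subst_apply hr hb,
    MvPowerSeries.subst_comp_subst_apply MvPowerSeries.HasSubst.X_X hb, h12] at h
  have e1 : (fun s => MvPowerSeries.subst ![X 0, X 1, (0 : MvPowerSeries (Fin 2) R)]
      (![F.toPowerSeries.subst ![X 0, X 1], X 2] s : MvPowerSeries (Fin 3) R)) =
      ![F.toPowerSeries, 0] := by
    funext s
    fin_cases s
    · simp [MvPowerSeries.subst_comp_subst_apply MvPowerSeries.HasSubst.X_X hb, h01,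
        MvPowerSeries.subst_self]
    · simp [MvPowerSeries.subst_X hb]
  have e2 : (fun s => MvPowerSeries.subst ![X 0, X 1, (0 : MvPowerSeries (Fin 2) R)]
      (![X 0, F.toPowerSeries.subst ![X 1, X 2]] s : MvPowerSeries (Fin 3) R)) = X := by
    funext s
    fin_cases s
    · simp [MvPowerSeries.subst_X hb]
    · simpa [MvPowerSeries.subst_comp_subst_apply MvPowerSeries.HasSubst.X_X hb, h12] using
        F.add_zero (PowerSeries.HasSubst.X 1)
  rw [e1, e2, MvPowerSeries.subst_self] at h
  rw [F.subst_partialTwo F.zero_constantCoeff, F.subst_partialTwo (MvPowerSeries.constantCoeff_X 1)]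
  exact h

end General

end FormalGroup

/-! ### Characters as eigenvectors of the invariant derivation -/

namespace FormalGroup

section General

variable {R : Type*} [CommRing R] (F : FormalGroup R) {σ : Type*}

open MvPowerSeries (X)

theorem invDeriv_mul (f g : PowerSeries R) :
    F.invDeriv (f * g) = f * F.invDeriv g + g * F.invDeriv f := by
  simp only [invDeriv, Derivation.leibniz, smul_eq_mul]
  ring

theorem invDeriv_C_mul (c : R) (f : PowerSeries R) :
    F.invDeriv (PowerSeries.C c * f) = PowerSeries.C c * F.invDeriv f := by
  simp [invDeriv, mul_left_comm]

theorem beta_one (f : PowerSeries R) :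
    F.beta 1 f = PowerSeries.constantCoeff (PowerSeries.derivative R f) := by
  simp [beta, invDeriv, constantCoeff_partialTwo]

theorem hasSubst : PowerSeries.HasSubst F.toPowerSeries :=
  PowerSeries.HasSubst.of_constantCoeff_zero F.zero_constantCoeff

theorem subst_invDeriv_add (g : PowerSeries R) :
    (F.invDeriv g).subst F.toPowerSeries = F.partialTwo.subst (X 1 : MvPowerSeries (Fin 2) R) *
      MvPowerSeries.pderiv R 1 (g.subst F.toPowerSeries) := by
  rw [invDeriv, PowerSeries.subst_mul F.hasSubst, subst_partialTwo_add,
    PowerSeries.pderiv_subst F.hasSubst]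
  ring

/-- Characters of `F` are eigenvectors of the invariant derivation. -/
theorem invDeriv_eq_of_mem_dualTate {g : PowerSeries R} (hg : g ∈ F.dualTate) :
    F.invDeriv g = PowerSeries.C (F.beta 1 g) * g := by
  have h := congrArg (MvPowerSeries.pderiv R 1) hg.2
  have h0 : PowerSeries.HasSubst (X 0 : MvPowerSeries (Fin 2) R) := PowerSeries.HasSubst.X 0
  have h1 : PowerSeries.HasSubst (X 1 : MvPowerSeries (Fin 2) R) := PowerSeries.HasSubst.X 1
  rw [PowerSeries.pderiv_subst F.hasSubst, Derivation.leibniz, PowerSeries.pderiv_subst h0,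
    PowerSeries.pderiv_subst h1, MvPowerSeries.pderiv_X_of_ne (show (0 : Fin 2) ≠ 1 by decide),
    MvPowerSeries.pderiv_X_self] at h
  have hb : MvPowerSeries.HasSubst ![(PowerSeries.X : PowerSeries R), 0] :=
    hasSubst_pair (by simp [PowerSeries.X]) (map_zero _)
  have key : ∀ (a : MvPowerSeries (Fin 2) R), PowerSeries.HasSubst a → ∀ f : PowerSeries R,
      (f.subst a).subst ![(PowerSeries.X : PowerSeries R), 0] =
        f.subst (a.subst ![(PowerSeries.X : PowerSeries R), 0]) := fun a ha f =>
    MvPowerSeries.subst_comp_subst_apply ha.const hb f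
  replace h := congrArg (MvPowerSeries.subst ![(PowerSeries.X : PowerSeries R), 0]) h
  simp only [smul_eq_mul, mul_zero, _root_.add_zero, mul_one] at h
  rw [MvPowerSeries.subst_mul hb, MvPowerSeries.subst_mul hb, key _ F.hasSubst, key _ h0,
    key _ h1, F.add_zero PowerSeries.HasSubst.X', MvPowerSeries.subst_X hb,
    MvPowerSeries.subst_X hb] at h
  simp only [Matrix.cons_val_zero, Matrix.cons_val_one, PowerSeries.X_subst] at h
  rw [beta_one, mul_comm (PowerSeries.C _), invDeriv, mul_comm, partialTwo, h,
    PowerSeries.subst_zero_eq_C_constantCoeff]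
  simp [PowerSeries.C]

/-- A normalized eigenvector of the invariant derivation is determined by its eigenvalue: the
quotient of two of them has derivative zero. -/
theorem eq_of_invDeriv_eq [IsAddTorsionFree R] {g h : PowerSeries R} {c : R}
    (hg0 : PowerSeries.constantCoeff g = 1) (hh0 : PowerSeries.constantCoeff h = 1)
    (hg : F.invDeriv g = PowerSeries.C c * g) (hh : F.invDeriv h = PowerSeries.C c * h) :
    g = h := by
  obtain ⟨w, hw⟩ : h ∣ g := (PowerSeries.isUnit_iff_constantCoeff.2 (by simp [hh0])).dvd
  suffices w = 1 by simp [hw, this]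
  have hD : F.invDeriv w = 0 := by
    have := F.invDeriv_mul h w
    rw [← hw, hg, hh, hw] at this
    have hu : IsUnit h := PowerSeries.isUnit_iff_constantCoeff.2 (by simp [hh0])
    exact (hu.mul_right_eq_zero).1 (by linear_combination -this)
  refine PowerSeries.derivative.ext ?_ ?_
  · rw [PowerSeries.derivative_one]
    exact (F.isUnit_partialTwo.mul_right_eq_zero).1 hD
  · rw [map_one]
    simpa [hg0, hh0] using (congrArg PowerSeries.constantCoeff hw).symm

/-- A normalized eigenvector of the invariant derivation is a character: for `P(t) = F_2(t, 0)`,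
both `U = g(F(x, y))` and `U = g(x) g(y)` solve `P(y) ∂U/∂y = c U`, so that their ratio does not
depend on `y`, and by symmetry it does not depend on `x`. -/
theorem mem_dualTate_of_invDeriv_eq [IsAddTorsionFree R] [F.IsComm] {g : PowerSeries R} {c : R}
    (hg0 : PowerSeries.constantCoeff g = 1) (hg : F.invDeriv g = PowerSeries.C c * g) :
    g ∈ F.dualTate := by
  refine ⟨hg0, ?_⟩
  have h0 : PowerSeries.HasSubst (X 0 : MvPowerSeries (Fin 2) R) := PowerSeries.HasSubst.X 0
  have h1 : PowerSeries.HasSubst (X 1 : MvPowerSeries (Fin 2) R) := PowerSeries.HasSubst.X 1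
  set V : MvPowerSeries (Fin 2) R := g.subst (X 0) * g.subst (X 1) with hV
  have hc : ∀ a : MvPowerSeries (Fin 2) R, MvPowerSeries.constantCoeff a = 0 →
      MvPowerSeries.constantCoeff (g.subst a) = 1 := by
    intro a ha
    have hs := PowerSeries.HasSubst.of_constantCoeff_zero ha
    have := PowerSeries.constantCoeff_subst_eq_zero ha (g - 1) (by simp [hg0])
    rw [PowerSeries.subst_sub hs, ← PowerSeries.coe_substAlgHom hs, map_one, map_sub, map_one,
      sub_eq_zero] at this
    rwa [← PowerSeries.coe_substAlgHom hs]
  have hVu : IsUnit V := by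
    rw [MvPowerSeries.isUnit_iff_constantCoeff, hV, map_mul, hc _ (MvPowerSeries.constantCoeff_X _),
      hc _ (MvPowerSeries.constantCoeff_X _)]
    simp
  obtain ⟨w, hw⟩ : V ∣ g.subst F.toPowerSeries := hVu.dvd
  have hPu : IsUnit (F.partialTwo.subst (X 1 : MvPowerSeries (Fin 2) R)) := by
    rw [← PowerSeries.coe_substAlgHom h1]
    exact F.isUnit_partialTwo.map _
  have hC : ∀ {a : MvPowerSeries (Fin 2) R} (ha : PowerSeries.HasSubst a),
      (PowerSeries.C c * g).subst a = MvPowerSeries.C c * g.subst a := by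
    intro a ha
    rw [PowerSeries.subst_mul ha, PowerSeries.subst_C]
  have hU1 := F.subst_invDeriv_add g
  rw [hg, hC F.hasSubst] at hU1
  have hV1 : F.partialTwo.subst (X 1 : MvPowerSeries (Fin 2) R) * MvPowerSeries.pderiv R 1 V =
      MvPowerSeries.C c * V := by
    have : F.partialTwo.subst (X 1 : MvPowerSeries (Fin 2) R) *
        (PowerSeries.derivative R g).subst (X 1 : MvPowerSeries (Fin 2) R) =
          MvPowerSeries.C c * g.subst (X 1 : MvPowerSeries (Fin 2) R) := by
      rw [← hC h1, ← hg, invDeriv, PowerSeries.subst_mul h1]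
    rw [hV, Derivation.leibniz, PowerSeries.pderiv_subst h0, PowerSeries.pderiv_subst h1,
      MvPowerSeries.pderiv_X_of_ne (show (0 : Fin 2) ≠ 1 by decide), MvPowerSeries.pderiv_X_self]
    simp only [smul_eq_mul, mul_zero, _root_.add_zero, mul_one]
    linear_combination g.subst (X 0 : MvPowerSeries (Fin 2) R) * this
  -- the ratio `w` of the two solutions does not depend on `y`, nor, by symmetry, on `x`
  have hw1 : MvPowerSeries.pderiv R 1 w = 0 := by
    rw [hw, Derivation.leibniz, smul_eq_mul, smul_eq_mul] at hU1
    exact ((hPu.mul hVu).mul_right_eq_zero).1 (by linear_combination -hU1 - w * hV1)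
  have hX : MvPowerSeries.HasSubst ![(X 1 : MvPowerSeries (Fin 2) R), X 0] :=
    MvPowerSeries.HasSubst.X_X
  have hswap : w.subst ![X 1, X 0] = w := by
    have hVs : V.subst ![(X 1 : MvPowerSeries (Fin 2) R), X 0] = V := by
      rw [hV, MvPowerSeries.subst_mul hX, PowerSeries.subst, PowerSeries.subst,
        MvPowerSeries.subst_comp_subst_apply h0.const hX,
        MvPowerSeries.subst_comp_subst_apply h1.const hX]
      simp only [MvPowerSeries.subst_X hX, Matrix.cons_val_zero, Matrix.cons_val_one]
      rw [mul_comm]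
    have hUs : (g.subst F.toPowerSeries).subst ![(X 1 : MvPowerSeries (Fin 2) R), X 0] =
        g.subst F.toPowerSeries := by
      rw [PowerSeries.subst, MvPowerSeries.subst_comp_subst_apply F.hasSubst.const hX,
        ← IsComm.comm (F := F)]
    rw [hw, MvPowerSeries.subst_mul hX, hVs] at hUs
    exact hVu.mul_left_cancel hUs
  have hw0 : MvPowerSeries.pderiv R 0 w = 0 := by
    rw [← hswap, MvPowerSeries.pderiv_subst hX, Fin.sum_univ_two, hw1]
    simp only [Matrix.cons_val_zero, Matrix.cons_val_one]
    rw [MvPowerSeries.pderiv_X_of_ne (by decide), mul_zero, _root_.zero_add,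
      ← MvPowerSeries.coe_substAlgHom hX, map_zero, zero_mul]
  have : w = 1 := by
    refine MvPowerSeries.pderiv.ext (fun i => ?_) ?_
    · rw [MvPowerSeries.pderiv_one]
      fin_cases i
      · exact hw0
      · exact hw1
    · have := congrArg MvPowerSeries.constantCoeff hw
      rw [map_mul, hc _ F.zero_constantCoeff, hV, map_mul, hc _ (MvPowerSeries.constantCoeff_X _),
        hc _ (MvPowerSeries.constantCoeff_X _)] at this
      simpa using this.symm
  rw [hw, this, mul_one]

theorem nSeries_succ (n : ℕ) :
    F.nSeries (n + 1) = F.toPowerSeries.subst ![F.nSeries n, PowerSeries.X] := by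
  rw [nSeries, succ_nsmul, add_apply]
  rfl

theorem constantCoeff_nSeries (n : ℕ) : PowerSeries.constantCoeff (F.nSeries n) = 0 := by
  induction n with
  | zero => simp [nSeries]
  | succ n ih =>
    rw [nSeries_succ]
    exact F.constantCoeff_subst_pair ih (by simp [PowerSeries.X])

/-- A character maps the `n`-series to the `n`-th power. -/
theorem subst_nSeries_of_mem_dualTate {g : PowerSeries R} (hg : g ∈ F.dualTate) (n : ℕ) :
    g.subst (F.nSeries n) = g ^ n := by
  induction n with
  | zero =>
    have : F.nSeries 0 = 0 := by simp [nSeries]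
    rw [this]
    refine PowerSeries.subst_zero_eq_C_constantCoeff.trans ?_
    rw [hg.1]
    simp
  | succ n ih =>
    have h0 : PowerSeries.HasSubst (X 0 : MvPowerSeries (Fin 2) R) := PowerSeries.HasSubst.X 0
    have h1 : PowerSeries.HasSubst (X 1 : MvPowerSeries (Fin 2) R) := PowerSeries.HasSubst.X 1
    have hb : MvPowerSeries.HasSubst ![F.nSeries n, PowerSeries.X] :=
      hasSubst_pair (F.constantCoeff_nSeries n) (by simp [PowerSeries.X])
    have key : ∀ (a : MvPowerSeries (Fin 2) R), PowerSeries.HasSubst a → ∀ f : PowerSeries R,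
        (f.subst a).subst ![F.nSeries n, PowerSeries.X] =
          f.subst (a.subst ![F.nSeries n, PowerSeries.X]) := fun a ha f =>
      MvPowerSeries.subst_comp_subst_apply ha.const hb f
    have h := congrArg (MvPowerSeries.subst ![F.nSeries n, PowerSeries.X]) hg.2
    rw [MvPowerSeries.subst_mul hb, key _ F.hasSubst, key _ h0, key _ h1,
      MvPowerSeries.subst_X hb, MvPowerSeries.subst_X hb, ← F.nSeries_succ] at h
    rw [h, pow_succ, ← ih]
    simp [PowerSeries.X_subst]

end General

end FormalGroup

/-! ### Change of coefficients and the logarithm -/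

namespace PowerSeries

section

variable {R S : Type*} [CommRing R] [CommRing S]

theorem constantCoeff_subst_of_constantCoeff_zero {a : PowerSeries R}
    (ha : constantCoeff a = 0) (f : PowerSeries R) :
    constantCoeff (f.subst a) = constantCoeff f := by
  have hs := HasSubst.of_constantCoeff_zero' ha
  have := constantCoeff_subst_eq_zero (a := a) ha (f - C (constantCoeff f)) (by simp)
  rw [subst_sub hs, subst_C, map_sub, MvPowerSeries.constantCoeff_C, sub_eq_zero] at this
  exact this

theorem constantCoeff_map (e : R →+* S) (f : PowerSeries R) :
    constantCoeff (map e f) = e (constantCoeff f) := by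
  rw [← coeff_zero_eq_constantCoeff_apply, coeff_map, coeff_zero_eq_constantCoeff_apply]

theorem derivative_map (e : R →+* S) (f : PowerSeries R) :
    derivative S (map e f) = map e (derivative R f) := by
  ext n
  simp [coeff_derivative]

end

end PowerSeries

namespace FormalGroup

variable {R S : Type*} [CommRing R] [CommRing S] (F : FormalGroup R) (f : R →+* S)

theorem map_partialTwo : (F.map f).partialTwo = PowerSeries.map f F.partialTwo := by
  have hb : MvPowerSeries.HasSubst ![(PowerSeries.X : PowerSeries R), 0] :=
    hasSubst_pair (by simp [PowerSeries.X]) (map_zero _)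
  rw [partialTwo, partialTwo, PowerSeries.map, MvPowerSeries.map_subst hb]
  congr 1
  · funext s
    fin_cases s
    · exact (PowerSeries.map_X f).symm
    · simp
  · ext n
    simp [MvPowerSeries.coeff_pderiv]

theorem map_invDeriv (g : PowerSeries R) :
    (F.map f).invDeriv (PowerSeries.map f g) = PowerSeries.map f (F.invDeriv g) := by
  rw [invDeriv, map_partialTwo, PowerSeries.derivative_map, invDeriv, map_mul]

theorem map_nSeries (n : ℕ) :
    (F.map f).nSeries n = PowerSeries.map f (F.nSeries n) := by
  induction n with
  | zero => simp [nSeries]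
  | succ n ih =>
    have hb : MvPowerSeries.HasSubst ![F.nSeries n, PowerSeries.X] :=
      hasSubst_pair (F.constantCoeff_nSeries n) (by simp [PowerSeries.X])
    rw [nSeries_succ, nSeries_succ, PowerSeries.map, MvPowerSeries.map_subst hb, ih]
    congr 1
    funext s
    fin_cases s
    · rfl
    · exact (PowerSeries.map_X f).symm

instance [F.IsComm] : (F.map f).IsComm where
  comm := by
    have h := congrArg (MvPowerSeries.map f) (IsComm.comm (F := F))
    rw [MvPowerSeries.map_subst MvPowerSeries.HasSubst.X_X] at h
    refine h.trans (congrArg (fun a => MvPowerSeries.subst a _) (funext fun s => ?_))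
    fin_cases s <;> simp

section Field

variable {K : Type*} [Field K] (E : FormalGroup K)

theorem derivative_formalLog [CharZero K] :
    PowerSeries.derivative K E.formalLog = E.partialTwo⁻¹ := by
  ext n
  have : (n : K) + 1 ≠ 0 := Nat.cast_add_one_ne_zero n
  rw [PowerSeries.coeff_derivative, formalLog, PowerSeries.coeff_mk]
  simp [this]

theorem invDeriv_formalLog [CharZero K] : E.invDeriv E.formalLog = 1 := by
  rw [invDeriv, derivative_formalLog]
  exact PowerSeries.mul_inv_cancel _ (by simp [constantCoeff_partialTwo])

theorem constantCoeff_formalLog : PowerSeries.constantCoeff E.formalLog = 0 := by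
  rw [← PowerSeries.coeff_zero_eq_constantCoeff_apply]
  simp [formalLog]

theorem coeff_one_formalLog : PowerSeries.coeff 1 E.formalLog = 1 := by
  simp [formalLog, constantCoeff_partialTwo]

theorem hasSubst_formalLog : PowerSeries.HasSubst E.formalLog :=
  PowerSeries.HasSubst.of_constantCoeff_zero' E.constantCoeff_formalLog

variable [CharZero K]

/-- The exponential `exp(log_F(t))`, a character of `F` over a field of characteristic zero. -/
noncomputable def expLog : PowerSeries K :=
  (PowerSeries.exp K).subst E.formalLog

theorem invDeriv_expLog : E.invDeriv E.expLog = E.expLog := by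
  rw [invDeriv, expLog, PowerSeries.derivative_subst E.hasSubst_formalLog,
    PowerSeries.derivative_exp, mul_left_comm]
  exact (congrArg _ E.invDeriv_formalLog).trans (mul_one _)

theorem constantCoeff_expLog : PowerSeries.constantCoeff E.expLog = 1 := by
  rw [expLog, PowerSeries.constantCoeff_subst_of_constantCoeff_zero E.constantCoeff_formalLog]
  simp

theorem expLog_mem_dualTate [E.IsComm] : E.expLog ∈ E.dualTate :=
  E.mem_dualTate_of_invDeriv_eq (c := 1) E.constantCoeff_expLog (by simp [invDeriv_expLog])

end Field

end FormalGroup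

/-! ### Dwork's integrality lemma -/

namespace PowerSeries

variable {p : ℕ} [hp : Fact p.Prime]

theorem subst_X_pow_zmod (f : PowerSeries (ZMod p)) :
    f.subst (X ^ p : PowerSeries (ZMod p)) = f ^ p := by
  have h := MvPowerSeries.map_frobenius_expand (R := ZMod p) p hp.1.ne_zero (f := f)
  rw [ZMod.frobenius_zmod, MvPowerSeries.map_id] at h
  rw [← expand_apply p hp.1.ne_zero]
  exact h

/-- Dwork's integrality lemma for a lift `φ` of Frobenius with `φ'(0) = p`: a power series
`f = 1 + t + ⋯` over `ℚ_p` with `f(φ(t)) = f(t)^p` has coefficients in `ℤ_p`. -/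
theorem exists_map_eq_of_subst_eq_pow {φ : PowerSeries ℤ_[p]} (hφ0 : constantCoeff φ = 0)
    (hφ1 : coeff 1 φ = p) (hφ : map (PadicInt.toZMod (p := p)) φ = X ^ p)
    {f : PowerSeries ℚ_[p]} (hf0 : constantCoeff f = 1) (hf1 : coeff 1 f = 1)
    (hf : f.subst (map (PadicInt.Coe.ringHom (p := p)) φ) = f ^ p) :
    ∃ g : PowerSeries ℤ_[p], map (PadicInt.Coe.ringHom (p := p)) g = f := by
  set ι := PadicInt.Coe.ringHom (p := p) with hι
  suffices h : ∀ n, ∃ c : ℤ_[p], ι c = coeff n f by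
    choose c hc using h
    exact ⟨mk c, ext fun n => by simpa using hc n⟩
  intro n
  induction n using Nat.strong_induction_on with
  | _ n ih =>
  rcases Nat.lt_or_ge n 2 with hn | hn
  · interval_cases n
    · exact ⟨1, by simp [hf0]⟩
    · exact ⟨1, by simp [hf1]⟩
  choose! c hc using ih
  -- `G` is the part of `f` of degree `< n`, and `f = G + X ^ n * r`.
  set G : PowerSeries ℤ_[p] := mk fun m => if m < n then c m else 0 with hG
  obtain ⟨r, hr⟩ : X ^ n ∣ f - map ι G := by
    rw [X_pow_dvd_iff]
    intro m hm
    simp [hG, hm, hc m hm]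
  have hr0 : coeff n f = constantCoeff r := by
    have := congrArg (coeff n) hr
    simpa [hG, coeff_X_pow_mul'] using this
  replace hr : f = map ι G + X ^ n * r := by rw [← hr]; ring
  have hG0 : constantCoeff (map ι G) = 1 := by
    have := hc 0 (by lia)
    rw [← coeff_zero_eq_constantCoeff_apply, coeff_map, hG, coeff_mk, if_pos (by lia), this,
      coeff_zero_eq_constantCoeff_apply, hf0]
  have hs : HasSubst φ := HasSubst.of_constantCoeff_zero' hφ0
  have hs' : HasSubst (map ι φ) := HasSubst.of_constantCoeff_zero' (by
    rw [← coeff_zero_eq_constantCoeff_apply, coeff_map, coeff_zero_eq_constantCoeff_apply, hφ0,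
      map_zero])
  -- the coefficients of `t ^ n` in the two sides of `f(φ(t)) = f(t) ^ p`
  have hl : coeff n (f.subst (map ι φ)) =
      ι (coeff n (G.subst φ)) + (p : ℚ_[p]) ^ n * constantCoeff r := by
    obtain ⟨u, hu⟩ := X_dvd_iff.2 hφ0
    have hu0 : constantCoeff u = p := by
      rw [← hφ1, hu, ← zero_add 1, coeff_succ_X_mul, coeff_zero_eq_constantCoeff_apply]
    have e1 : map ι (G.subst φ) = (map ι G).subst (map ι φ) := map_subst hs G
    have e2 : (X ^ n * r : PowerSeries ℚ_[p]).subst (map ι φ) =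
        X ^ n * (map ι u ^ n * r.subst (map ι φ)) := by
      rw [subst_mul hs', subst_pow hs', subst_X hs', ← mul_assoc, ← mul_pow]
      congr 2
      rw [hu, map_mul, map_X]
    rw [hr, subst_add hs', ← e1, e2, map_add, coeff_map, coeff_X_pow_mul', if_pos le_rfl,
      Nat.sub_self, coeff_zero_eq_constantCoeff_apply, map_mul, map_pow,
      constantCoeff_subst_of_constantCoeff_zero (by
        rw [← coeff_zero_eq_constantCoeff_apply, coeff_map, coeff_zero_eq_constantCoeff_apply, hφ0,
          map_zero]), ← coeff_zero_eq_constantCoeff_apply (map ι u), coeff_map,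
      coeff_zero_eq_constantCoeff_apply, hu0, map_natCast]
  have hrr : coeff n (f ^ p) = ι (coeff n (G ^ p)) + p * constantCoeff r := by
    obtain ⟨k, hk⟩ := Polynomial.powAddExpansion (map ι G) (X ^ n * r) p
    have e : k * (X ^ n * r) ^ 2 = X ^ (n + n) * (k * r ^ 2) := by ring
    have e' : (p : PowerSeries ℚ_[p]) * map ι G ^ (p - 1) * (X ^ n * r) =
        X ^ n * ((p : PowerSeries ℚ_[p]) * map ι G ^ (p - 1) * r) := by ring
    rw [hr, hk, e, e', ← map_pow (map ι), map_add, map_add, coeff_map, coeff_X_pow_mul',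
      if_pos le_rfl, coeff_X_pow_mul', if_neg (by lia), Nat.sub_self,
      coeff_zero_eq_constantCoeff_apply, map_mul,
      map_mul, map_pow constantCoeff, hG0]
    simp
  -- modulo `p` both `G(φ(t))` and `G(t) ^ p` are `G(t ^ p)`
  have hmod : PadicInt.toZMod (coeff n (G ^ p) - coeff n (G.subst φ)) = 0 := by
    have e1 : map PadicInt.toZMod (G.subst φ) = map PadicInt.toZMod (G ^ p) := by
      refine (map_subst hs G).trans ?_
      refine (congrArg (fun a => subst a _) hφ).trans ?_
      rw [subst_X_pow_zmod, map_pow]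
    rw [map_sub, ← coeff_map, ← coeff_map, e1, sub_self]
  have hmem : coeff n (G ^ p) - coeff n (G.subst φ) ∈ IsLocalRing.maximalIdeal ℤ_[p] := by
    rw [← PadicInt.ker_toZMod]
    exact hmod
  rw [PadicInt.maximalIdeal_eq_span_p, Ideal.mem_span_singleton] at hmem
  obtain ⟨s, hs⟩ := hmem
  have hu : IsUnit ((p : ℤ_[p]) ^ (n - 1) - 1) := by
    have h1 : (p : ℤ_[p]) ^ (n - 1) ∈ nonunits ℤ_[p] := by
      rw [PadicInt.mem_nonunits]
      exact (norm_pow _ _).trans_lt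
        (pow_lt_one₀ (norm_nonneg _) (PadicInt.mem_nonunits.1 PadicInt.p_nonunit) (by lia))
    rcases IsLocalRing.isUnit_or_isUnit_one_sub_self ((p : ℤ_[p]) ^ (n - 1)) with h | h
    · exact absurd h h1
    · rw [← neg_sub]
      exact h.neg
  obtain ⟨v, hv⟩ := hu
  have hp0 : (p : ℚ_[p]) ≠ 0 := Nat.cast_ne_zero.2 hp.1.ne_zero
  refine ⟨(v⁻¹ : ℤ_[p]ˣ) * s, ?_⟩
  rw [hr0]
  have key : (p : ℚ_[p]) * (ι v * constantCoeff r) = p * ι s := by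
    have e : ι (coeff n (G ^ p)) - ι (coeff n (G.subst φ)) = p * ι s := by
      rw [← map_sub, hs, map_mul, map_natCast]
    rw [← e, hv, map_sub, map_pow, map_natCast, map_one]
    have hpn : (p : ℚ_[p]) ^ n = p * p ^ (n - 1) := by
      rw [← pow_succ']
      congr 1
      lia
    have := hl.symm.trans ((congrArg (coeff n) hf).trans hrr)
    rw [hpn] at this
    linear_combination this
  rw [map_mul, ← mul_left_cancel₀ hp0 key, ← mul_assoc, ← map_mul, Units.inv_mul, map_one, one_mul]

end PowerSeries

/-! ### Continuity of substitution -/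

namespace MvPowerSeries

open scoped MvPowerSeries.WithPiTopology in
/-- Substitution is continuous for the topology of coefficientwise convergence, for any ring
topology on the coefficients: each coefficient of the result depends on finitely many
coefficients of the argument. -/
theorem continuous_subst_of_isTopologicalRing {σ τ R : Type*} [CommRing R] [TopologicalSpace R]
    [IsTopologicalRing R] {a : σ → MvPowerSeries τ R} (ha : HasSubst a) :
    Continuous (subst a : MvPowerSeries σ R → MvPowerSeries τ R) := by
  refine continuous_pi fun e => ?_
  have hfin : (Function.support fun d : σ →₀ ℕ =>
      coeff e (d.prod fun s n => a s ^ n)).Finite := by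
    refine Set.Finite.subset (coeff_subst_finite ha (fun _ => 1 : MvPowerSeries σ R) e)
      fun d hd h0 => hd ?_
    exact (one_smul R _).symm.trans h0
  have : (fun f : MvPowerSeries σ R => subst a f e) = fun f =>
      ∑ d ∈ hfin.toFinset, coeff d f • coeff e (d.prod fun s n => a s ^ n) := by
    funext f
    refine (coeff_subst ha f e).trans (finsum_eq_sum_of_support_subset _ fun d hd => ?_)
    rw [Set.Finite.coe_toFinset, Function.mem_support]
    exact fun h0 => hd (by simp only [h0, smul_zero])
  rw [this]
  exact continuous_finsetSum _ fun d _ =>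
    (WithPiTopology.continuous_coeff R d).mul continuous_const

end MvPowerSeries

namespace PowerSeries

theorem continuous_subst {R : Type*} [CommRing R] [TopologicalSpace R] [IsTopologicalRing R]
    {a : PowerSeries R} (ha : HasSubst a) :
    Continuous (subst a : PowerSeries R → PowerSeries R) :=
  MvPowerSeries.continuous_subst_of_isTopologicalRing ha.const

end PowerSeries

/-! ### The invariant derivation of the multiplicative group -/

theorem PadicInt.choose_succ_mul {p : ℕ} [Fact p.Prime] (a : ℤ_[p]) (n : ℕ) :
    Ring.choose a (n + 1) * ((n : ℤ_[p]) + 1) = Ring.choose a n * (a - n) := by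
  have := Ring.choose_smul_choose a (Nat.le_succ n)
  simp at this
  linear_combination this

namespace PowerSeries

section SubOne

variable {R : Type*} [CommRing R]

theorem constantCoeff_sub_one {b : PowerSeries R} (hb0 : constantCoeff b = 1) :
    constantCoeff (b - 1) = 0 := by
  rw [map_sub, hb0, map_one, sub_self]

theorem hasSubst_sub_one {b : PowerSeries R} (hb0 : constantCoeff b = 1) : HasSubst (b - 1) :=
  HasSubst.of_constantCoeff_zero' (constantCoeff_sub_one hb0)

theorem one_subst {a : PowerSeries R} (ha : HasSubst a) :
    (1 : PowerSeries R).subst a = (1 : PowerSeries R) := by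
  rw [← coe_substAlgHom ha, map_one]

theorem sub_one_subst {a : PowerSeries R} (ha : HasSubst a) (f : PowerSeries R) :
    (f - 1).subst a = (f.subst a : PowerSeries R) - 1 := by
  rw [subst_sub ha, one_subst ha]

theorem one_add_X_subst_sub_one {b : PowerSeries R} (hb0 : constantCoeff b = 1) :
    (1 + X : PowerSeries R).subst (b - 1) = b := by
  have hs := hasSubst_sub_one hb0
  rw [subst_add hs, subst_X hs, one_subst hs, add_sub_cancel]

end SubOne

section MulDeriv

variable {R : Type*} [CommRing R]

/-- The invariant derivation `(1 + T) d/dT` of the multiplicative formal group. -/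
noncomputable def mulDeriv (f : PowerSeries R) : PowerSeries R :=
  (1 + X) * derivative R f

theorem constantCoeff_mulDeriv (f : PowerSeries R) : constantCoeff (mulDeriv f) = coeff 1 f := by
  rw [mulDeriv, map_mul, ← coeff_zero_eq_constantCoeff_apply (derivative R f), coeff_derivative]
  simp

theorem continuous_mulDeriv [TopologicalSpace R] [IsTopologicalRing R] :
    Continuous (mulDeriv : PowerSeries R → PowerSeries R) :=
  continuous_const.mul (MvPowerSeries.continuous_pderiv ())

theorem mulDeriv_mul (f g : PowerSeries R) :
    mulDeriv (f * g) = f * mulDeriv g + g * mulDeriv f := by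
  simp only [mulDeriv, Derivation.leibniz, smul_eq_mul]
  ring

theorem mulDeriv_C_mul (c : R) (f : PowerSeries R) : mulDeriv (C c * f) = C c * mulDeriv f := by
  simp [mulDeriv, mul_left_comm]

theorem mulDeriv_add (f g : PowerSeries R) : mulDeriv (f + g) = mulDeriv f + mulDeriv g := by
  simp only [mulDeriv, map_add, mul_add]

theorem mulDeriv_sub (f g : PowerSeries R) : mulDeriv (f - g) = mulDeriv f - mulDeriv g := by
  simp only [mulDeriv, map_sub, mul_sub]

theorem mulDeriv_sum {ι : Type*} (s : Finset ι) (f : ι → PowerSeries R) :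
    mulDeriv (∑ i ∈ s, f i) = ∑ i ∈ s, mulDeriv (f i) := by
  simp only [mulDeriv, map_sum, Finset.mul_sum]

theorem mulDeriv_map {S : Type*} [CommRing S] (e : R →+* S) (f : PowerSeries R) :
    mulDeriv (map e f) = map e (mulDeriv f) := by
  rw [mulDeriv, derivative_map, mulDeriv, map_mul, map_add, map_one, map_X]

theorem iterate_mulDeriv_map {S : Type*} [CommRing S] (e : R →+* S) (f : PowerSeries R) (k : ℕ) :
    mulDeriv^[k] (map e f) = map e (mulDeriv^[k] f) := by
  induction k generalizing f with
  | zero => rfl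
  | succ k ih => rw [Function.iterate_succ_apply, mulDeriv_map, ih]; rfl

/-- Logarithmic derivatives of products. -/
theorem mulDeriv_prod {ι : Type*} (s : Finset ι) {f h : ι → PowerSeries R}
    (hf : ∀ i ∈ s, mulDeriv (f i) = h i * f i) :
    mulDeriv (∏ i ∈ s, f i) = (∑ i ∈ s, h i) * ∏ i ∈ s, f i := by
  classical
  induction s using Finset.induction_on with
  | empty => simp [mulDeriv]
  | insert i s hi ih =>
    rw [Finset.prod_insert hi, Finset.sum_insert hi, mulDeriv_mul,
      ih fun j hj => hf j (Finset.mem_insert_of_mem hj), hf i (Finset.mem_insert_self i s)]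
    ring

/-- If `mulDeriv b = a b`, then substituting `b - 1` scales the derivation by `a`: this applies to
`b = (1 + T) ^ a`. -/
theorem mulDeriv_subst_sub_one {b : PowerSeries R} (hb0 : constantCoeff b = 1) {a : R}
    (hb : mulDeriv b = C a * b) (f : PowerSeries R) :
    mulDeriv (f.subst (b - 1)) = C a * (mulDeriv f).subst (b - 1) := by
  have hs := hasSubst_sub_one hb0
  have h2 : (1 + X) * derivative R (b - 1) = C a * b := by
    rw [map_sub, Derivation.map_one_eq_zero, sub_zero]
    exact hb
  rw [mulDeriv, derivative_subst hs, mulDeriv, subst_mul hs, one_add_X_subst_sub_one hb0,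
    mul_left_comm, h2]
  ring

theorem iterate_mulDeriv_C_mul (c : R) (f : PowerSeries R) (k : ℕ) :
    mulDeriv^[k] (C c * f) = C c * mulDeriv^[k] f := by
  induction k generalizing f with
  | zero => rfl
  | succ k ih => rw [Function.iterate_succ_apply, mulDeriv_C_mul, ih]; rfl

theorem iterate_mulDeriv_sub (f g : PowerSeries R) (k : ℕ) :
    mulDeriv^[k] (f - g) = mulDeriv^[k] f - mulDeriv^[k] g := by
  induction k generalizing f g with
  | zero => rfl
  | succ k ih => rw [Function.iterate_succ_apply, mulDeriv_sub, ih]; rfl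

theorem iterate_mulDeriv_subst_sub_one {b : PowerSeries R} (hb0 : constantCoeff b = 1) {a : R}
    (hb : mulDeriv b = C a * b) (f : PowerSeries R) (k : ℕ) :
    mulDeriv^[k] (f.subst (b - 1)) = C (a ^ k) * (mulDeriv^[k] f).subst (b - 1) := by
  induction k generalizing f with
  | zero => simp
  | succ k ih =>
    rw [Function.iterate_succ_apply, mulDeriv_subst_sub_one hb0 hb, iterate_mulDeriv_C_mul, ih,
      ← mul_assoc, ← map_mul, pow_succ']
    rfl

theorem mulDeriv_one_add_X_pow (n : ℕ) :
    mulDeriv ((1 + X : PowerSeries R) ^ n) = C (n : R) * (1 + X) ^ n := by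
  induction n with
  | zero => simp [mulDeriv]
  | succ n ih =>
    rw [pow_succ, mulDeriv_mul, ih]
    simp [mulDeriv]
    ring

theorem constantCoeff_one_add_X_pow (n : ℕ) :
    constantCoeff ((1 + X : PowerSeries R) ^ n) = 1 := by simp

end MulDeriv

section Binomial

variable {p : ℕ} [hp : Fact p.Prime]

theorem continuous_binomialSeries :
    Continuous fun a : ℤ_[p] => binomialSeries ℤ_[p] a := by
  refine continuous_pi fun d => ?_
  have : (fun a : ℤ_[p] => binomialSeries ℤ_[p] a d) = fun a => Ring.choose a (d ()) := by
    funext a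
    have hd : d = Finsupp.single () (d ()) :=
      Finsupp.ext fun u => by cases u; exact Finsupp.single_eq_same.symm
    have h := binomialSeries_coeff (A := ℤ_[p]) a (d ())
    rw [smul_eq_mul, mul_one] at h
    exact (congrArg (binomialSeries ℤ_[p] a) hd).trans h
  rw [this]
  exact PadicInt.continuous_choose _

/-- `(1 + T) ^ a` is an eigenvector of the derivation, with eigenvalue `a`. -/
theorem mulDeriv_binomialSeries (a : ℤ_[p]) :
    mulDeriv (binomialSeries ℤ_[p] a) = C a * binomialSeries ℤ_[p] a := by
  ext n
  rw [mulDeriv, add_mul, one_mul, map_add, coeff_C_mul]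
  rcases n with _ | n
  · rw [coeff_zero_X_mul, coeff_derivative]
    simp
  · rw [coeff_succ_X_mul, coeff_derivative, coeff_derivative]
    simp only [binomialSeries_coeff, smul_eq_mul, mul_one]
    have h := PadicInt.choose_succ_mul a (n + 1)
    push_cast at h ⊢
    linear_combination h

theorem binomialSeries_natCast_mul (n : ℕ) (b : ℤ_[p]) :
    binomialSeries ℤ_[p] (n * b) = binomialSeries ℤ_[p] b ^ n := by
  induction n with
  | zero => simp
  | succ n ih =>
    rw [Nat.cast_succ, add_mul, one_mul, binomialSeries_add, ih, pow_succ]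

theorem binomialSeries_subst_one_add_X_pow (n : ℕ) (b : ℤ_[p]) :
    (binomialSeries ℤ_[p] b).subst ((1 + X) ^ n - 1 : PowerSeries ℤ_[p]) =
      binomialSeries ℤ_[p] b ^ n := by
  have hs : HasSubst ((1 + X) ^ n - 1 : PowerSeries ℤ_[p]) :=
    hasSubst_sub_one (constantCoeff_one_add_X_pow n)
  -- Both sides are continuous in `b`, so that `b` may be assumed to be a natural number.
  refine DFunLike.congr_fun (f := (⟨_, (continuous_subst hs).comp continuous_binomialSeries⟩ :
    C(ℤ_[p], PowerSeries ℤ_[p]))) (g :=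
      ⟨fun a => binomialSeries ℤ_[p] a ^ n, continuous_binomialSeries.pow n⟩) ?_ b
  refine ContinuousMap.coe_injective (PadicInt.denseRange_natCast.equalizer
    (map_continuous _) (map_continuous _) (funext fun k => ?_))
  simp only [Function.comp_apply, ContinuousMap.coe_mk, binomialSeries_nat]
  rw [subst_pow hs, one_add_X_subst_sub_one (constantCoeff_one_add_X_pow n), pow_right_comm]

end Binomial

end PowerSeries

/-! ### The group of characters -/

namespace FormalGroup

variable {p : ℕ} [hp : Fact p.Prime] {F : FormalGroup ℤ_[p]}

/-- A formal group law over `ℤ_p` with `[p]_F(t) ≡ t ^ p` modulo `p` has a character `1 + t + ⋯`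
over `ℤ_p`, the series `exp(log_F(t))`: it is integral by Dwork's lemma, as it takes `[p]_F(t)`
to its `p`-th power. -/
theorem exists_invDeriv_eq_self [F.IsComm]
    (h : PowerSeries.map (PadicInt.toZMod (p := p)) (F.nSeries p) = PowerSeries.X ^ p) :
    ∃ g : PowerSeries ℤ_[p], PowerSeries.constantCoeff g = 1 ∧ F.invDeriv g = g := by
  set ι := PadicInt.Coe.ringHom (p := p) with hι
  have hinj : Function.Injective (PowerSeries.map ι) :=
    PowerSeries.map_injective _ Subtype.val_injective
  set e := (F.map ι).expLog with he
  have he0 : PowerSeries.constantCoeff e = 1 := (F.map ι).constantCoeff_expLog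
  have hDe : (F.map ι).invDeriv e = e := (F.map ι).invDeriv_expLog
  have hd0 : PowerSeries.constantCoeff (PowerSeries.derivative _ e) = 1 := by
    rw [← beta_one (F.map ι), beta, Function.iterate_one, hDe, he0]
  have he1 : PowerSeries.coeff 1 e = 1 := by
    have := PowerSeries.coeff_derivative e 0
    rw [PowerSeries.coeff_zero_eq_constantCoeff_apply, hd0] at this
    simpa using this.symm
  have hpow : e.subst (PowerSeries.map ι (F.nSeries p)) = e ^ p := by
    rw [← map_nSeries]
    exact (F.map ι).subst_nSeries_of_mem_dualTate (F.map ι).expLog_mem_dualTate p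
  have hφ0 : PowerSeries.constantCoeff (PowerSeries.map ι (F.nSeries p)) = 0 := by
    rw [← map_nSeries]
    exact constantCoeff_nSeries _ _
  have hφ1 : PowerSeries.coeff 1 (F.nSeries p) = p := by
    have h1 := congrArg (fun f => PowerSeries.constantCoeff (PowerSeries.derivative ℚ_[p] f)) hpow
    simp only [PowerSeries.derivative_subst (PowerSeries.HasSubst.of_constantCoeff_zero' hφ0),
      map_mul, PowerSeries.constantCoeff_subst_of_constantCoeff_zero hφ0, hd0,
      PowerSeries.derivative_pow, map_pow, he0] at h1
    have h2 := PowerSeries.coeff_derivative (PowerSeries.map ι (F.nSeries p)) 0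
    rw [PowerSeries.coeff_zero_eq_constantCoeff_apply] at h2
    rw [h2, PowerSeries.coeff_map] at h1
    have h3 : ι (PowerSeries.coeff 1 (F.nSeries p)) = ι p := by
      rw [map_natCast]
      simpa using h1
    exact Subtype.val_injective h3
  obtain ⟨g, hg⟩ := PowerSeries.exists_map_eq_of_subst_eq_pow (F.constantCoeff_nSeries p) hφ1 h
    he0 he1 hpow
  refine ⟨g, ?_, hinj ?_⟩
  · have h1 : ι (PowerSeries.constantCoeff g) = ι 1 := by
      rw [map_one, ← he0, ← hg]
      simp only [← PowerSeries.coeff_zero_eq_constantCoeff_apply, PowerSeries.coeff_map, hι]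
    exact Subtype.val_injective h1
  · rw [← map_invDeriv, hg, hDe]

section Character

variable {g : PowerSeries ℤ_[p]}

/-- The power `g ^ a`, for `a ∈ ℤ_p`, of a power series `g` with constant term `1`. -/
noncomputable def charPow (g : PowerSeries ℤ_[p]) (a : ℤ_[p]) : PowerSeries ℤ_[p] :=
  (PowerSeries.binomialSeries ℤ_[p] a).subst (g - 1)

theorem constantCoeff_charPow (hg0 : PowerSeries.constantCoeff g = 1) (a : ℤ_[p]) :
    PowerSeries.constantCoeff (charPow g a) = 1 := by
  rw [charPow, PowerSeries.constantCoeff_subst_of_constantCoeff_zero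
    (PowerSeries.constantCoeff_sub_one hg0)]
  simp

theorem invDeriv_charPow (hg0 : PowerSeries.constantCoeff g = 1) (hg : F.invDeriv g = g)
    (a : ℤ_[p]) : F.invDeriv (charPow g a) = PowerSeries.C a * charPow g a := by
  have hs := PowerSeries.hasSubst_sub_one hg0
  have h1 := congrArg (PowerSeries.subst (g - 1)) (PowerSeries.mulDeriv_binomialSeries a)
  rw [PowerSeries.mulDeriv, PowerSeries.subst_mul hs, PowerSeries.subst_mul hs,
    PowerSeries.subst_C, PowerSeries.one_add_X_subst_sub_one hg0] at h1
  rw [invDeriv] at hg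
  rw [invDeriv, charPow, PowerSeries.derivative_subst hs, map_sub, PowerSeries.derivative_one,
    sub_zero]
  refine Eq.trans ?_ h1
  linear_combination
    PowerSeries.subst (g - 1) (PowerSeries.derivative ℤ_[p] (PowerSeries.binomialSeries ℤ_[p] a)) *
      hg

theorem beta_one_of_invDeriv_eq {f : PowerSeries ℤ_[p]} {a : ℤ_[p]}
    (hf0 : PowerSeries.constantCoeff f = 1) (hf : F.invDeriv f = PowerSeries.C a * f) :
    F.beta 1 f = a := by
  rw [beta, Function.iterate_one, hf, map_mul, hf0]
  simp

theorem continuous_charPow (hg0 : PowerSeries.constantCoeff g = 1) : Continuous (charPow g) :=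
  (PowerSeries.continuous_subst (PowerSeries.hasSubst_sub_one hg0)).comp
    PowerSeries.continuous_binomialSeries

/-- If `F` has a character `g = 1 + t + ⋯`, then `β^1` identifies the group of characters of `F`
with `ℤ_p`; the inverse map is `a ↦ g ^ a`. -/
noncomputable def dualTateHomeomorph [F.IsComm] (hg0 : PowerSeries.constantCoeff g = 1)
    (hg : F.invDeriv g = g) : F.dualTate ≃ₜ ℤ_[p] where
  toFun f := F.beta 1 (f : PowerSeries ℤ_[p])
  invFun a := ⟨charPow g a, F.mem_dualTate_of_invDeriv_eq (constantCoeff_charPow hg0 a)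
    (invDeriv_charPow hg0 hg a)⟩
  left_inv f := Subtype.ext <| F.eq_of_invDeriv_eq (constantCoeff_charPow hg0 _) f.2.1
    (invDeriv_charPow hg0 hg _) (F.invDeriv_eq_of_mem_dualTate f.2)
  right_inv a := beta_one_of_invDeriv_eq (constantCoeff_charPow hg0 a) (invDeriv_charPow hg0 hg a)
  continuous_toFun := (F.continuous_beta 1).comp continuous_subtype_val
  continuous_invFun := (continuous_charPow hg0).subtype_mk _

theorem beta_one_mul (f h : F.dualTate) :
    F.beta 1 ((f * h : F.dualTate) : PowerSeries ℤ_[p]) =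
      F.beta 1 (f : PowerSeries ℤ_[p]) + F.beta 1 (h : PowerSeries ℤ_[p]) := by
  simp only [beta_one, Submonoid.coe_mul, Derivation.leibniz, smul_eq_mul, map_add, map_mul,
    f.2.1, h.2.1]
  ring

/-- Since `β^1` takes `h ^ p` to `p β^1(h)`, the complement of the `p`-th powers corresponds to the
complement of `p ℤ_p`. -/
theorem mem_dualTateUnits_iff [F.IsComm] (hg0 : PowerSeries.constantCoeff g = 1)
    (hg : F.invDeriv g = g) (f : F.dualTate) :
    f ∈ F.dualTateUnits p ↔ IsUnit (dualTateHomeomorph hg0 hg f) := by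
  set e := dualTateHomeomorph hg0 hg with he
  have hpow : ∀ (h : F.dualTate) (n : ℕ), e (h ^ n) = n * e h := by
    intro h n
    induction n with
    | zero =>
      have := beta_one_mul (1 : F.dualTate) 1
      rw [mul_one, left_eq_add] at this
      rw [pow_zero, Nat.cast_zero, zero_mul]
      exact this
    | succ n ih =>
      rw [pow_succ]
      refine (beta_one_mul _ _).trans ?_
      change e (h ^ n) + e h = _
      rw [ih]
      push_cast
      ring
  rw [← not_iff_not]
  change ¬¬ (∃ h : F.dualTate, h ^ p = f) ↔ _
  rw [not_not, ← mem_nonunits_iff, ← IsLocalRing.mem_maximalIdeal,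
    PadicInt.maximalIdeal_eq_span_p, Ideal.mem_span_singleton]
  constructor
  · rintro ⟨h, rfl⟩
    exact ⟨e h, hpow h p⟩
  · rintro ⟨c, hc⟩
    refine ⟨e.symm c, e.injective ?_⟩
    rw [hpow, e.apply_symm_apply, hc]

/-- `β^1` identifies the complement of the `p`-th powers of characters with `ℤ_p^×`. -/
noncomputable def dualTateUnitsHomeomorph [F.IsComm] (hg0 : PowerSeries.constantCoeff g = 1)
    (hg : F.invDeriv g = g) : F.dualTateUnits p ≃ₜ ℤ_[p]ˣ :=
  ((dualTateHomeomorph hg0 hg).subtype (q := fun x => x ∈ Set.range (Units.val : ℤ_[p]ˣ → ℤ_[p]))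
    fun f => mem_dualTateUnits_iff hg0 hg f).trans
      Units.isOpenEmbedding_val.isEmbedding.toHomeomorph.symm

theorem coe_dualTateUnitsHomeomorph [F.IsComm] (hg0 : PowerSeries.constantCoeff g = 1)
    (hg : F.invDeriv g = g) (f : F.dualTateUnits p) :
    (dualTateUnitsHomeomorph hg0 hg f : ℤ_[p]) = dualTateHomeomorph hg0 hg f := by
  have := (Units.isOpenEmbedding_val (R := ℤ_[p])).isEmbedding.toHomeomorph.apply_symm_apply
    ((dualTateHomeomorph hg0 hg).subtype (q := fun x => x ∈ Set.range (Units.val : ℤ_[p]ˣ → ℤ_[p]))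
      (fun f => mem_dualTateUnits_iff hg0 hg f) f)
  exact congrArg Subtype.val this

end Character

end FormalGroup

/-! ### The ring of integers of `ℂ_p` -/

namespace PadicComplex

variable (p : ℕ) [hp : Fact p.Prime]

/-- The ring of integers of `ℂ_p`, as the closed unit ball. -/
def ball : Subring ℂ_[p] where
  carrier := {x | ‖x‖ ≤ 1}
  mul_mem' {x y} hx hy := by
    change ‖x * y‖ ≤ 1
    rw [norm_mul]
    exact mul_le_one₀ hx (norm_nonneg _) hy
  one_mem' := by simp
  add_mem' {x y} hx hy := (IsUltrametricDist.norm_add_le_max x y).trans (max_le hx hy)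
  zero_mem' := by simp
  neg_mem' {x} hx := by simpa using hx

theorem isClosed_ball : IsClosed (ball p : Set ℂ_[p]) :=
  isClosed_le continuous_norm continuous_const

instance : CompleteSpace (ball p) :=
  (isClosed_ball p).completeSpace_coe

theorem ball_norm_le_one (x : ball p) : ‖x‖ ≤ 1 := x.2

/-- The ideal of elements of norm less than `ε` in the ring of integers of `ℂ_p`. -/
def ballIdeal (ε : ℝ) (hε : 0 < ε) : Ideal (ball p) where
  carrier := {x | ‖x‖ < ε}
  add_mem' {x y} hx hy := (IsUltrametricDist.norm_add_le_max x y).trans_lt (max_lt hx hy)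
  zero_mem' := by simpa using hε
  smul_mem' c x hx := by
    exact (norm_mul_le c x).trans_lt <|
      (mul_le_of_le_one_left (norm_nonneg _) (ball_norm_le_one p c)).trans_lt hx

theorem mem_ballIdeal {ε : ℝ} (hε : 0 < ε) {x : ball p} : x ∈ ballIdeal p ε hε ↔ ‖x‖ < ε :=
  Iff.rfl

instance : IsLinearTopology (ball p) (ball p) := by
  refine IsLinearTopology.mk_of_hasBasis (ball p) (ι := Set.Ioi (0 : ℝ)) (p := fun _ => True)
    (s := fun ε => ballIdeal p ε ε.2) ⟨fun t => ?_⟩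
  rw [Metric.mem_nhds_iff]
  constructor
  · rintro ⟨ε, hε, h⟩
    exact ⟨⟨ε, hε⟩, trivial, fun x hx => h (by simpa using (mem_ballIdeal p hε).1 hx)⟩
  · rintro ⟨ε, -, h⟩
    exact ⟨ε, ε.2, fun x hx => h ((mem_ballIdeal p ε.2).2 (by simpa using hx))⟩

theorem norm_toCp (x : ℤ_[p]) : ‖FormalGroup.toCp p x‖ = ‖x‖ := by
  change ‖algebraMap ℚ_[p] ℂ_[p] (x : ℚ_[p])‖ = ‖x‖
  rw [norm_algebraMap', PadicInt.norm_def]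

noncomputable instance : Algebra ℤ_[p] (ball p) :=
  ((FormalGroup.toCp p).codRestrict (ball p) fun x => by
    change ‖_‖ ≤ 1
    rw [norm_toCp]
    exact x.norm_le_one).toAlgebra

theorem coe_algebraMap (x : ℤ_[p]) : ((algebraMap ℤ_[p] (ball p) x : ball p) : ℂ_[p]) =
    FormalGroup.toCp p x := rfl

theorem algebraMap_injective : Function.Injective (algebraMap ℤ_[p] (ball p)) := fun x y h => by
  have := congrArg (Subtype.val) h
  rw [coe_algebraMap, coe_algebraMap] at this
  rw [← sub_eq_zero, ← norm_eq_zero, ← norm_toCp, map_sub, this, sub_self, norm_zero]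

instance : ContinuousSMul ℤ_[p] (ball p) := by
  refine continuousSMul_of_algebraMap _ _ ?_
  refine (AddMonoidHomClass.isometry_of_norm _ fun x => ?_).continuous
  exact norm_toCp p x

theorem hasEval {x : ball p} (hx : ‖x‖ < 1) : PowerSeries.HasEval x :=
  tendsto_pow_atTop_nhds_zero_of_norm_lt_one hx

end PadicComplex

/-! ### Evaluation of power series -/

namespace PowerSeries

section Topology

variable {R : Type*} [CommRing R] [UniformSpace R] [IsTopologicalRing R] [IsUniformAddGroup R]
variable {S : Type*} [CommRing S] [UniformSpace S] [IsUniformAddGroup S] [CompleteSpace S]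
  [T2Space S] [IsTopologicalRing S] [IsLinearTopology S S] [Algebra R S] [ContinuousSMul R S]
variable {S' : Type*} [CommRing S'] [UniformSpace S'] [IsUniformAddGroup S'] [CompleteSpace S']
  [T2Space S'] [IsTopologicalRing S'] [IsLinearTopology S' S'] [Algebra R S'] [ContinuousSMul R S']

/-- Continuous homomorphisms commute with the evaluation of power series. -/
theorem algHom_aeval {ε : S →ₐ[R] S'} (hε : Continuous ε) {a : S} (ha : HasEval a) {b : S'}
    (hb : HasEval b) (h : ε a = b) (f : PowerSeries R) : ε (aeval ha f) = aeval hb f := by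
  subst h
  exact DFunLike.congr_fun (comp_aeval ha hε) f

open scoped MvPowerSeries.WithPiTopology in
/-- The evaluation of `f(a)` at a point is the evaluation of `f` at the value of `a`. -/
theorem mvAeval_subst {τ : Type*} {b : τ → S} (hb : MvPowerSeries.HasEval b)
    {a : MvPowerSeries τ R} (ha : HasSubst a) {c : S} (hc : HasEval c)
    (h : MvPowerSeries.aeval (R := R) hb a = c) (f : PowerSeries R) :
    MvPowerSeries.aeval hb (f.subst a) = aeval hc f := by
  subst h
  have hcont : Continuous ((MvPowerSeries.aeval (R := R) hb).comp (substAlgHom ha)) := by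
    refine (MvPowerSeries.continuous_aeval hb).comp ?_
    have := MvPowerSeries.continuous_subst_of_isTopologicalRing (R := R) ha.const
    exact this.congr fun g => (congrFun (coe_substAlgHom ha) g).symm
  have h1 := DFunLike.congr_fun (aeval_unique hcont) f
  rw [AlgHom.comp_apply, coe_substAlgHom] at h1
  rw [← h1]
  congr 2
  exact congrArg (MvPowerSeries.aeval (R := R) hb) (substAlgHom_X ha)

theorem aeval_subst {b : S} (hb : HasEval b) {a : PowerSeries R} (ha : HasSubst a) {c : S}
    (hc : HasEval c) (h : aeval hb a = c) (f : PowerSeries R) :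
    aeval hb (f.subst a) = aeval hc f :=
  mvAeval_subst (hasEval hb) ha hc h f

theorem aeval_X {a : S} (ha : HasEval a) : aeval ha (X : PowerSeries R) = a := by
  rw [← Polynomial.coe_X, aeval_coe, Polynomial.aeval_X]

end Topology

end PowerSeries

/-! ### The Ando condition over the ring of integers -/

namespace FormalGroup

open PadicComplex

variable {p : ℕ} [hp : Fact p.Prime] (F : FormalGroup ℤ_[p])

/-- The sum that defines `F[p]`, taken in `ℂ_p`, is the value of the power series in the ring of
integers. -/
theorem coe_aeval_eq_tsum {c : ball p} (hc : ‖c‖ < 1) (f : PowerSeries ℤ_[p]) :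
    ((PowerSeries.aeval (hasEval p hc) f : ball p) : ℂ_[p]) =
      ∑' n : ℕ, toCp p (PowerSeries.coeff n f) * (c : ℂ_[p]) ^ n :=
  ((PowerSeries.hasSum_aeval (hasEval p hc) f).map (ball p).subtype
    continuous_subtype_val).tsum_eq.symm

theorem mem_torsion_iff {c : ball p} (hc : ‖c‖ < 1) :
    (c : ℂ_[p]) ∈ F.torsion ↔ PowerSeries.aeval (hasEval p hc) (F.nSeries p) = 0 := by
  rw [← Subtype.coe_inj, coe_aeval_eq_tsum hc]
  exact ⟨fun h => h.2, fun h => ⟨hc, h⟩⟩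

open scoped MvPowerSeries.WithPiTopology in
theorem hasEval_pair {x y : PowerSeries (ball p)} (hx : ‖PowerSeries.constantCoeff x‖ < 1)
    (hy : ‖PowerSeries.constantCoeff y‖ < 1) : MvPowerSeries.HasEval ![x, y] where
  hpow s := by
    fin_cases s
    · exact MvPowerSeries.LinearTopology.isTopologicallyNilpotent_of_constantCoeff (hasEval p hx)
    · exact MvPowerSeries.LinearTopology.isTopologicallyNilpotent_of_constantCoeff (hasEval p hy)
  tendsto_zero := by simp

/-- The translate `t +_F c` with coefficients in the ring of integers of `ℂ_p`. -/
noncomputable def ballTranslate (c : ball p) (hc : ‖c‖ < 1) : PowerSeries (ball p) :=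
  MvPowerSeries.aeval (R := ℤ_[p])
    (hasEval_pair (x := PowerSeries.X) (y := PowerSeries.C c) (by simp) (by simpa using hc))
    F.toPowerSeries

theorem map_ballTranslate (c : ball p) (hc : ‖c‖ < 1) :
    PowerSeries.map (ball p).subtype (F.ballTranslate c hc) = F.translate c := by
  ext i
  rw [PowerSeries.coeff_map, translate, PowerSeries.coeff_mk]
  have h := MvPowerSeries.hasSum_aeval (R := ℤ_[p])
    (hasEval_pair (x := PowerSeries.X) (y := PowerSeries.C c) (by simp) (by simpa using hc))
    F.toPowerSeries
  replace h := (h.map (PowerSeries.coeff (R := ball p) i)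
    (PowerSeries.WithPiTopology.continuous_coeff (ball p) i)).map (ball p).subtype
    continuous_subtype_val
  have hg : Function.Injective
      (fun j : ℕ => (Finsupp.single 0 i + Finsupp.single 1 j : Fin 2 →₀ ℕ)) := by
    intro j k hjk
    simpa using DFunLike.congr_fun hjk 1
  rw [← hg.hasSum_iff] at h
  · rw [ballTranslate, ← h.tsum_eq]
    refine tsum_congr fun j => ?_
    simp only [Function.comp_apply]
    rw [Finsupp.prod_fintype _ _ (by simp), Fin.prod_univ_two]
    simp only [Matrix.cons_val_zero, Matrix.cons_val_one, Finsupp.add_apply, Finsupp.single_apply]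
    simp [← map_pow, PowerSeries.coeff_mul_C, Algebra.smul_def, PowerSeries.algebraMap_apply,
      PowerSeries.coeff_C_mul, coe_algebraMap]
  · intro d hd
    have hdi : d 0 ≠ i := by
      rintro rfl
      refine hd ⟨d 1, Finsupp.ext fun s => ?_⟩
      fin_cases s <;> simp
    simp only [Function.comp_apply]
    rw [Finsupp.prod_fintype _ _ (by simp), Fin.prod_univ_two]
    simp [← map_pow, PowerSeries.coeff_mul_C, PowerSeries.coeff_X_pow, hdi.symm]

/-- Modulo the maximal ideal of the ring of integers of `ℂ_p`, translation by a point of the open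
unit disc is trivial. -/
theorem map_mk_ballTranslate (c : ball p) (hc : ‖c‖ < 1) :
    PowerSeries.map (Ideal.Quotient.mk (ballIdeal p 1 one_pos)) (F.ballTranslate c hc) =
      PowerSeries.X := by
  obtain ⟨G, hG⟩ : (MvPowerSeries.X 1 : MvPowerSeries (Fin 2) ℤ_[p]) ∣
      F.toPowerSeries - MvPowerSeries.X 0 := by
    rw [MvPowerSeries.X_dvd_iff]
    intro d hd
    have h := congrArg (PowerSeries.coeff (d 0)) F.Xzero_eq_X
    have hs : MvPowerSeries.HasSubst ![(PowerSeries.X : PowerSeries ℤ_[p]), 0] :=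
      hasSubst_pair (by simp [PowerSeries.X]) (map_zero _)
    have hd0 : d = Finsupp.single 0 (d 0) := Finsupp.ext fun s => by
      fin_cases s <;> simp [hd]
    have e : PowerSeries.coeff (d 0) F.Xzero = MvPowerSeries.coeff d F.toPowerSeries := by
      rw [PowerSeries.coeff, Xzero, MvPowerSeries.coeff_subst hs, finsum_eq_single _ d]
      · rw [Finsupp.prod_fintype _ _ (by simp), Fin.prod_univ_two]
        simp only [Matrix.cons_val_zero, Matrix.cons_val_one, hd, pow_zero, mul_one]
        change _ • PowerSeries.coeff (d 0) (PowerSeries.X ^ d 0) = _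
        simp [PowerSeries.coeff_X_pow]
      · intro d' hd'
        rw [Finsupp.prod_fintype _ _ (by simp), Fin.prod_univ_two]
        simp only [Matrix.cons_val_zero, Matrix.cons_val_one]
        by_cases h1 : d' 1 = 0
        · have : d' 0 ≠ d 0 := fun h0 => hd' (Finsupp.ext fun s => by
            fin_cases s
            · exact h0
            · simp [h1, hd])
          rw [h1, pow_zero, mul_one]
          change _ • PowerSeries.coeff (d 0) (PowerSeries.X ^ d' 0) = _
          simp [PowerSeries.coeff_X_pow, this.symm]
        · simp [h1]
    have hiff : d = Finsupp.single 0 1 ↔ d 0 = 1 :=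
      ⟨fun h => by rw [h]; simp, fun h => by rw [hd0, h]⟩
    rw [map_sub, ← e, h, PowerSeries.coeff_X, MvPowerSeries.coeff_X]
    simp [hiff]
  have hF : F.toPowerSeries = MvPowerSeries.X 0 + MvPowerSeries.X 1 * G := by
    rw [← hG]
    ring
  have hX : ∀ s : Fin 2, MvPowerSeries.aeval (R := ℤ_[p]) (hasEval_pair (x := PowerSeries.X)
      (y := PowerSeries.C c) (by simp) (by simpa using hc)) (MvPowerSeries.X s) =
        ![PowerSeries.X, PowerSeries.C c] s := by
    intro s
    rw [← MvPolynomial.coe_X, MvPowerSeries.aeval_coe, MvPolynomial.aeval_X]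
  rw [ballTranslate, hF, map_add, map_mul, hX, hX]
  have h0 : Ideal.Quotient.mk (ballIdeal p 1 one_pos) c = 0 :=
    Ideal.Quotient.eq_zero_iff_mem.2 ((mem_ballIdeal p one_pos).2 hc)
  simp [h0]

end FormalGroup

namespace FormalGroup

open PadicComplex

variable {p : ℕ} [hp : Fact p.Prime] (F : FormalGroup ℤ_[p])

theorem mk_algebraMap_eq_zero_iff (x : ℤ_[p]) :
    Ideal.Quotient.mk (ballIdeal p 1 one_pos) (algebraMap ℤ_[p] (ball p) x) = 0 ↔
      PadicInt.toZMod x = 0 := by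
  rw [Ideal.Quotient.eq_zero_iff_mem, mem_ballIdeal, ← RingHom.mem_ker, PadicInt.ker_toZMod,
    IsLocalRing.mem_maximalIdeal, PadicInt.mem_nonunits, ← norm_toCp]
  rfl

variable {F} in
/-- The Ando condition over the ring of integers of `ℂ_p`. Modulo the maximal ideal every translate
of `t` is `t`, so that `[p]_F(t)` is `t ^ #F[p]` modulo `p`; by the assumption on the height this
gives `#F[p] = p` and `[p]_F(t) ≡ t ^ p`. -/
theorem AndoCondition.exists_finset (hF : F.HasHeightOne) (hAndo : F.AndoCondition) :
    ∃ T : Finset {c : ball p // ‖c‖ < 1},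
      (∀ c ∈ T, PowerSeries.aeval (hasEval p c.2) (F.nSeries p) = 0) ∧ T.card = p ∧
      ∏ c ∈ T, F.ballTranslate c.1 c.2 =
        PowerSeries.map (algebraMap ℤ_[p] (ball p)) (F.nSeries p) ∧
      PowerSeries.map (PadicInt.toZMod (p := p)) (F.nSeries p) = PowerSeries.X ^ p := by
  classical
  let j : {c : ball p // ‖c‖ < 1} → ℂ_[p] := fun c => c.1
  have hj : Function.Injective j := Subtype.val_injective.comp Subtype.val_injective
  set s := j ⁻¹' F.torsion with hs
  have himg : F.torsion = j '' s := by
    rw [hs, Set.image_preimage_eq_iff.2]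
    intro c hc
    exact ⟨⟨⟨c, hc.1.le⟩, hc.1⟩, rfl⟩
  have hmap : Function.Injective (PowerSeries.map (ball p).subtype) :=
    PowerSeries.map_injective _ Subtype.val_injective
  have hmk : (1 : PowerSeries (ball p ⧸ ballIdeal p 1 one_pos)) ≠ PowerSeries.X := by
    have : Nontrivial (ball p ⧸ ballIdeal p 1 one_pos) := by
      refine Ideal.Quotient.nontrivial_iff.2 ((Ideal.ne_top_iff_one _).2 fun h => ?_)
      have := (mem_ballIdeal p one_pos).1 h
      simp at this
    intro h
    have := congrArg PowerSeries.constantCoeff h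
    simp at this
  have htop : ∏ᶠ c ∈ s, F.ballTranslate c.1 c.2 =
      PowerSeries.map (algebraMap ℤ_[p] (ball p)) (F.nSeries p) := by
    apply hmap
    have h : ∏ᶠ c ∈ F.torsion, F.translate c =
        PowerSeries.map (toCp p) (F.nSeries p) := hAndo
    rw [himg, finprod_mem_image hj.injOn] at h
    have h2 : PowerSeries.map (ball p).subtype
        (PowerSeries.map (algebraMap ℤ_[p] (ball p)) (F.nSeries p)) =
          PowerSeries.map (toCp p) (F.nSeries p) := by
      ext n
      simp [coe_algebraMap]
    rw [h2, ← h]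
    have := (PowerSeries.map (ball p).subtype).toMonoidHom.map_finprod_of_injective hmap
      (fun c => ∏ᶠ _ : c ∈ s, F.ballTranslate c.1 c.2)
    refine this.trans (finprod_congr fun c => ?_)
    refine ((PowerSeries.map (ball p).subtype).toMonoidHom.map_finprod_of_injective hmap
      (fun _ : c ∈ s => F.ballTranslate c.1 c.2)).trans (finprod_congr fun _ => ?_)
    exact F.map_ballTranslate c.1 c.2
  -- over an infinite set the product would have the junk value `1`, as no translate equals `1`
  have hfin : s.Finite := by
    by_contra hinf
    have hsupp : s ∩ Function.mulSupport (fun c => F.ballTranslate c.1 c.2) = s := by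
      refine Set.inter_eq_left.2 fun c _ h => hmk ?_
      have h1 := F.map_mk_ballTranslate c.1 c.2
      rw [← h1]
      exact (map_one (PowerSeries.map _)).symm.trans (congrArg _ h.symm)
    rw [finprod_mem_eq_one_of_infinite (by rwa [hsupp])] at htop
    have := congrArg PowerSeries.constantCoeff htop
    rw [map_one, ← PowerSeries.coeff_zero_eq_constantCoeff_apply, PowerSeries.coeff_map,
      PowerSeries.coeff_zero_eq_constantCoeff_apply, F.constantCoeff_nSeries, map_zero] at this
    exact one_ne_zero this
  rw [finprod_mem_eq_finite_toFinset_prod _ hfin] at htop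
  have hpow : PowerSeries.map (PadicInt.toZMod (p := p)) (F.nSeries p) =
      PowerSeries.X ^ hfin.toFinset.card := by
    have h := congrArg (PowerSeries.map (Ideal.Quotient.mk (ballIdeal p 1 one_pos))) htop
    rw [map_prod, Finset.prod_congr rfl fun c _ => F.map_mk_ballTranslate c.1 c.2,
      Finset.prod_const] at h
    ext n
    have hn := congrArg (PowerSeries.coeff n) h
    rw [PowerSeries.coeff_map, PowerSeries.coeff_map, PowerSeries.coeff_X_pow] at hn
    rw [PowerSeries.coeff_map, PowerSeries.coeff_X_pow]
    split_ifs at hn ⊢ with h'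
    · rw [← sub_eq_zero, ← map_one PadicInt.toZMod, ← map_sub, ← mk_algebraMap_eq_zero_iff,
        map_sub, map_sub, ← hn, map_one, map_one, sub_self]
    · exact (mk_algebraMap_eq_zero_iff _).1 hn.symm
  have hcard : hfin.toFinset.card = p := by
    have h : (PowerSeries.map (PadicInt.toZMod (p := p)) (F.nSeries p)).order = (p : ℕ∞) := hF
    rw [hpow, PowerSeries.order_X_pow] at h
    exact_mod_cast h
  refine ⟨hfin.toFinset, fun c hc => ?_, hcard, htop, hpow.trans (by rw [hcard])⟩
  rw [Set.Finite.mem_toFinset] at hc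
  exact (F.mem_torsion_iff c.2).1 hc

end FormalGroup

/-! ### Mahler transforms -/

namespace PowerSeries

section Mahler

open PadicInt fwdDiff

variable {p : ℕ} [hp : Fact p.Prime]

theorem hasSum_coeff_mul_fwdDiff (f : PowerSeries ℤ_[p]) (φ : C(ℤ_[p], ℤ_[p])) :
    HasSum (fun n => coeff n f * (fwdDiff 1)^[n] φ 0)
      (∑' n, coeff n f * (fwdDiff 1)^[n] φ 0) := by
  refine (NonarchimedeanAddGroup.summable_of_tendsto_cofinite_zero ?_).hasSum
  rw [Nat.cofinite_eq_atTop]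
  refine squeeze_zero_norm (fun n => ?_)
    (tendsto_zero_iff_norm_tendsto_zero.1 (fwdDiff_tendsto_zero φ))
  rw [norm_mul]
  exact mul_le_of_le_one_left (norm_nonneg _) (PadicInt.norm_le_one _)

/-- The functional on continuous functions on `ℤ_p` with Mahler transform `f`: the `n`-th
coefficient of `f` is the integral of the `n`-th binomial coefficient function. -/
noncomputable def mahlerFunctional (f : PowerSeries ℤ_[p]) : C(ℤ_[p], ℤ_[p]) →L[ℤ_[p]] ℤ_[p] where
  toFun φ := ∑' n, coeff n f * (fwdDiff 1)^[n] φ 0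
  map_add' φ ψ := by
    rw [← ((hasSum_coeff_mul_fwdDiff f φ).add (hasSum_coeff_mul_fwdDiff f ψ)).tsum_eq]
    refine tsum_congr fun n => ?_
    rw [ContinuousMap.coe_add, fwdDiff_iter_add, Pi.add_apply, mul_add]
  map_smul' c φ := by
    rw [RingHom.id_apply, smul_eq_mul, ← ((hasSum_coeff_mul_fwdDiff f φ).mul_left c).tsum_eq]
    refine tsum_congr fun n => ?_
    rw [ContinuousMap.coe_smul, fwdDiff_iter_const_smul, Pi.smul_apply, smul_eq_mul]
    ring
  cont := by
    let L : C(ℤ_[p], ℤ_[p]) →+ ℤ_[p] :=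
      { toFun := fun φ => ∑' n, coeff n f * (fwdDiff 1)^[n] φ 0
        map_zero' := by
          refine (tsum_congr fun n => ?_).trans tsum_zero
          have : (fwdDiff (1 : ℤ_[p]))^[n] (⇑(0 : C(ℤ_[p], ℤ_[p]))) 0 = 0 :=
            norm_le_zero_iff.1
              ((IsUltrametricDist.norm_fwdDiff_iter_apply_le 1 (0 : C(ℤ_[p], ℤ_[p])) 0 n).trans
                norm_zero.le)
          rw [this, mul_zero]
        map_add' := fun φ ψ => by
          rw [← ((hasSum_coeff_mul_fwdDiff f φ).add (hasSum_coeff_mul_fwdDiff f ψ)).tsum_eq]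
          refine tsum_congr fun n => ?_
          rw [ContinuousMap.coe_add, fwdDiff_iter_add, Pi.add_apply, mul_add] }
    refine AddMonoidHomClass.continuous_of_bound L 1 fun φ => ?_
    refine (IsUltrametricDist.norm_tsum_le _).trans (ciSup_le fun n => ?_)
    rw [norm_mul, one_mul]
    exact (mul_le_of_le_one_left (norm_nonneg _) (PadicInt.norm_le_one _)).trans
      (IsUltrametricDist.norm_fwdDiff_iter_apply_le 1 φ 0 n)

theorem hasSum_mahlerFunctional (f : PowerSeries ℤ_[p]) (φ : C(ℤ_[p], ℤ_[p])) :
    HasSum (fun n => coeff n f * (fwdDiff 1)^[n] φ 0) (mahlerFunctional f φ) :=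
  hasSum_coeff_mul_fwdDiff f φ

theorem mahlerFunctional_mahler (f : PowerSeries ℤ_[p]) (n : ℕ) :
    mahlerFunctional f (mahler n) = coeff n f := by
  have h0 : Filter.Tendsto (Pi.single n (1 : ℤ_[p]) : ℕ → ℤ_[p]) Filter.atTop (nhds 0) :=
    tendsto_const_nhds.congr' <| (Filter.eventually_gt_atTop n).mono fun m hm => by
      rw [Pi.single_eq_of_ne hm.ne']
  have h1 : mahlerSeries (Pi.single n (1 : ℤ_[p])) = (mahler n : C(ℤ_[p], ℤ_[p])) := by
    rw [mahlerSeries, tsum_eq_single n, Pi.single_eq_same, mahlerTerm_one]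
    intro m hm
    rw [Pi.single_eq_of_ne hm]
    ext x
    simp [mahlerTerm_apply]
  refine (hasSum_mahlerFunctional f _).unique ?_
  have h2 : ∀ m, (fwdDiff 1)^[m] (mahler n : C(ℤ_[p], ℤ_[p])) 0 =
      (Pi.single n (1 : ℤ_[p]) : ℕ → ℤ_[p]) m := fun m => by rw [← h1, fwdDiff_mahlerSeries h0]
  simp only [h2]
  have h3 := hasSum_single (f := fun m => coeff m f * (Pi.single n (1 : ℤ_[p]) : ℕ → ℤ_[p]) m) n
    fun m hm => by rw [Pi.single_eq_of_ne hm, mul_zero]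
  rwa [Pi.single_eq_same, mul_one] at h3

/-- The binomial coefficient functions span a dense submodule of the continuous functions. -/
theorem ext_mahler {L M : C(ℤ_[p], ℤ_[p]) →L[ℤ_[p]] ℤ_[p]}
    (h : ∀ n, L (mahler n) = M (mahler n)) : L = M := by
  ext φ
  have hs := hasSum_mahler φ
  have key : ∀ n (a : ℤ_[p]), L (mahlerTerm a n) = M (mahlerTerm a n) := fun n a => by
    have : (mahlerTerm a n : C(ℤ_[p], ℤ_[p])) = a • mahler n := by
      ext x
      simp [mahlerTerm_apply, mul_comm]
    rw [this, map_smul, map_smul, h]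
  have h1 := hs.mapL L
  simp only [key] at h1
  exact h1.unique (hs.mapL M)

/-- Multiplication of functions by `x` corresponds to the derivation `(1 + T) d/dT` of Mahler
transforms, since `x C(x, n) = (n + 1) C(x, n + 1) + n C(x, n)`. -/
theorem mahlerFunctional_id_mul (f : PowerSeries ℤ_[p]) (φ : C(ℤ_[p], ℤ_[p])) :
    mahlerFunctional f (ContinuousMap.id ℤ_[p] * φ) = mahlerFunctional (mulDeriv f) φ := by
  refine DFunLike.congr_fun (ext_mahler (L := (mahlerFunctional f).comp
    ⟨LinearMap.mulLeft ℤ_[p] (ContinuousMap.id ℤ_[p]), continuous_const.mul continuous_id⟩)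
    fun n => ?_) φ
  have h : ContinuousMap.id ℤ_[p] * mahler n =
      ((n : ℤ_[p]) + 1) • mahler (n + 1) + (n : ℤ_[p]) • mahler n := by
    ext x
    have := choose_succ_mul x n
    simp only [ContinuousMap.mul_apply, ContinuousMap.add_apply, ContinuousMap.smul_apply,
      mahler_apply, ContinuousMap.id_apply, smul_eq_mul]
    linear_combination - this
  change mahlerFunctional f (ContinuousMap.id ℤ_[p] * mahler n) = _
  rw [h, map_add, map_smul,
    map_smul, mahlerFunctional_mahler, mahlerFunctional_mahler, mahlerFunctional_mahler, mulDeriv,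
    add_mul, one_mul, map_add, coeff_derivative]
  rcases n with _ | n
  · simp
  · rw [coeff_succ_X_mul, coeff_derivative]
    simp only [smul_eq_mul]
    push_cast
    ring

theorem mahlerFunctional_pow_mul (f : PowerSeries ℤ_[p]) (k : ℕ) (φ : C(ℤ_[p], ℤ_[p])) :
    mahlerFunctional f (ContinuousMap.id ℤ_[p] ^ k * φ) = mahlerFunctional (mulDeriv^[k] f) φ := by
  induction k generalizing f with
  | zero => rw [pow_zero, one_mul]; rfl
  | succ k ih => rw [pow_succ', mul_assoc, mahlerFunctional_id_mul, ih]; rfl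

theorem mahlerFunctional_one (f : PowerSeries ℤ_[p]) :
    mahlerFunctional f 1 = constantCoeff f := by
  rw [← coeff_zero_eq_constantCoeff_apply, ← mahlerFunctional_mahler]
  congr 1
  ext x
  simp [mahler_apply]

end Mahler

end PowerSeries

namespace PadicComplex

variable (p : ℕ) [hp : Fact p.Prime]

/-- The indicator function of `p ℤ_p`. -/
noncomputable def indicatorMul : C(ℤ_[p], ℤ_[p]) where
  toFun := Set.indicator {x | ‖x‖ < 1} 1
  continuous_toFun := by
    refine IsClopen.continuous_indicator ?_ continuous_one
    have : {x : ℤ_[p] | ‖x‖ < 1} = Metric.ball 0 1 := by ext; simp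
    rw [this]
    exact IsUltrametricDist.isClopen_ball 0 1

open scoped Classical in
theorem indicatorMul_natCast (n : ℕ) : indicatorMul p n = if p ∣ n then 1 else 0 := by
  change Set.indicator _ _ _ = _
  rw [Set.indicator_apply]
  simp [PadicInt.norm_natCast_lt_one_iff]

variable {p}

noncomputable instance : Fintype (rootsOfUnity p (ball p)) :=
  haveI : NeZero p := ⟨hp.out.ne_zero⟩
  Fintype.ofFinite _

/-- The `p`-th roots of unity are congruent to `1`, since `(ζ - 1) ^ p ≡ ζ ^ p - 1` modulo `p`. -/
theorem norm_sub_one_lt_one {ζ : ball p} (h : ζ ^ p = 1) : ‖ζ - 1‖ < 1 := by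
  obtain ⟨r, hr⟩ := exists_add_pow_prime_eq hp.out (ζ - 1) 1
  rw [sub_add_cancel, h, one_pow] at hr
  have h1 : (ζ - 1) ^ p = -((p : ball p) * ((ζ - 1) * 1 * r)) := by linear_combination - hr
  have h2 : ‖ζ - 1‖ ^ p < 1 := by
    have hpn : ‖(p : ball p)‖ < 1 := by
      have := norm_toCp p (p : ℤ_[p])
      rw [map_natCast] at this
      refine this.trans_lt ?_
      rw [PadicInt.norm_p]
      exact inv_lt_one_of_one_lt₀ (mod_cast hp.out.one_lt)
    have h3 : ‖(ζ - 1) ^ p‖ = ‖ζ - 1‖ ^ p := norm_pow ((ζ - 1 : ball p) : ℂ_[p]) p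
    rw [← h3, h1, norm_neg]
    exact (norm_mul_le _ _).trans_lt <|
      (mul_le_of_le_one_right (norm_nonneg _) (ball_norm_le_one p _)).trans_lt hpn
  exact lt_of_not_ge fun h => absurd h2 (not_lt.2 (one_le_pow₀ h))

theorem coe_pow_eq_one (ζ : rootsOfUnity p (ball p)) : ((ζ : (ball p)ˣ) : ball p) ^ p = 1 :=
  (mem_rootsOfUnity' p _).1 ζ.2

theorem norm_coe_sub_one_lt_one (ζ : rootsOfUnity p (ball p)) :
    ‖((ζ : (ball p)ˣ) : ball p) - 1‖ < 1 :=
  norm_sub_one_lt_one (coe_pow_eq_one ζ)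

open scoped Classical in
/-- Orthogonality of characters for the group of `p`-th roots of unity. -/
theorem sum_rootsOfUnity_pow (hcard : Nat.card (rootsOfUnity p (ball p)) = p) (k : ℕ) :
    ∑ ζ : rootsOfUnity p (ball p), ((ζ : (ball p)ˣ) : ball p) ^ k =
      if p ∣ k then (p : ball p) else 0 := by
  split_ifs with h
  · obtain ⟨m, rfl⟩ := h
    simp only [pow_mul, coe_pow_eq_one, one_pow]
    rw [Finset.sum_const, Finset.card_univ, ← Nat.card_eq_fintype_card, hcard, nsmul_eq_mul,
      mul_one]
  · let f : rootsOfUnity p (ball p) →* ball p :=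
      ((Units.coeHom _).comp (rootsOfUnity p (ball p)).subtype).comp (powMonoidHom k)
    refine (Finset.sum_congr rfl fun ζ _ => ?_).trans (sum_hom_units_eq_zero f fun hf => ?_)
    · simp [f]
    · have hinj : Function.Injective (fun ζ : rootsOfUnity p (ball p) => ζ ^ k) :=
        (powCoprime (by rw [hcard]; exact (Nat.Prime.coprime_iff_not_dvd hp.out).2 h)).injective
      have hs : Subsingleton (rootsOfUnity p (ball p)) := ⟨fun a b => hinj <| by
        have ha := DFunLike.congr_fun hf a
        have hb := DFunLike.congr_fun hf b
        exact Subtype.ext (Units.ext (ha.trans hb.symm))⟩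
      have := Nat.card_of_subsingleton (1 : rootsOfUnity p (ball p))
      exact hp.out.one_lt.ne (this.symm.trans hcard)

open PowerSeries in
/-- By orthogonality of characters of `ℤ/p`, integration over `p ℤ_p` is computed by the values of
the Mahler transform at the points `ζ - 1`, `ζ ^ p = 1`. -/
theorem mahlerFunctional_indicatorMul (hcard : Nat.card (rootsOfUnity p (ball p)) = p)
    (f : PowerSeries ℤ_[p]) :
    (p : ball p) * algebraMap ℤ_[p] (ball p) (mahlerFunctional f (indicatorMul p)) =
      ∑ ζ : rootsOfUnity p (ball p), aeval (hasEval p (norm_coe_sub_one_lt_one ζ)) f := by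
  have h1 := ((hasSum_mahlerFunctional f (indicatorMul p)).map (algebraMap ℤ_[p] (ball p))
    (continuous_algebraMap _ _)).mul_left (p : ball p)
  have h2 := hasSum_sum (s := Finset.univ) fun (ζ : rootsOfUnity p (ball p)) _ =>
    hasSum_aeval (hasEval p (norm_coe_sub_one_lt_one ζ)) f
  refine h1.unique ?_
  convert! h2 using 1
  funext n
  -- the `n`-th Mahler coefficient of the indicator function is `p⁻¹ ∑_ζ (ζ - 1) ^ n`
  have h3 : (fwdDiff 1)^[n] (indicatorMul p) 0 =
      ∑ k ∈ Finset.range (n + 1), ((-1 : ℤ_[p]) ^ (n - k) * (n.choose k : ℤ_[p])) *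
        indicatorMul p (k : ℤ_[p]) := by
    rw [fwdDiff_iter_eq_sum_shift]
    refine Finset.sum_congr rfl fun k _ => ?_
    simp [zsmul_eq_mul]
  have h4 : ∀ ζ : rootsOfUnity p (ball p), (((ζ : (ball p)ˣ) : ball p) - 1) ^ n =
      ∑ k ∈ Finset.range (n + 1), ((-1 : ball p) ^ (n - k) * (n.choose k : ball p)) *
        ((ζ : (ball p)ˣ) : ball p) ^ k := by
    intro ζ
    rw [sub_eq_add_neg, add_pow]
    exact Finset.sum_congr rfl fun k _ => by ring
  classical
  simp only [Function.comp_apply, h3, h4, Algebra.smul_def, indicatorMul_natCast]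
  rw [← Finset.mul_sum, Finset.sum_comm]
  simp only [← Finset.mul_sum, sum_rootsOfUnity_pow hcard]
  rw [map_mul, map_sum, mul_left_comm, Finset.mul_sum]
  congr 1
  refine Finset.sum_congr rfl fun k _ => ?_
  split_ifs <;> simp [mul_comm]

end PadicComplex

/-! ### Translation by roots of unity -/

namespace PadicComplex

open PowerSeries

variable {p : ℕ} [hp : Fact p.Prime]

theorem hasEval_powerSeries {x : PowerSeries (ball p)} (hx : ‖constantCoeff x‖ < 1) : HasEval x :=
  MvPowerSeries.LinearTopology.isTopologicallyNilpotent_of_constantCoeff (hasEval p hx)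

theorem continuous_map_algebraMap :
    Continuous (map (algebraMap ℤ_[p] (ball p)) : PowerSeries ℤ_[p] → PowerSeries (ball p)) :=
  continuous_pi fun d => (continuous_algebraMap ℤ_[p] (ball p)).comp (continuous_apply d)

theorem hasEval_X : HasEval (X : PowerSeries (ball p)) :=
  hasEval_powerSeries (by simp)

theorem aeval_X_eq_map (f : PowerSeries ℤ_[p]) :
    aeval (hasEval_X (p := p)) f = map (algebraMap ℤ_[p] (ball p)) f := by
  have hε : Continuous (mapAlgHom (Algebra.ofId ℤ_[p] (ball p)) :
      PowerSeries ℤ_[p] →ₐ[ℤ_[p]] PowerSeries (ball p)) := continuous_map_algebraMap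
  have h : ∀ (y : PowerSeries (ball p)) (hy : HasEval y), y = X →
      aeval (R := ℤ_[p]) hasEval_X f = aeval hy f := by
    rintro _ _ rfl
    rfl
  exact (h _ _ (map_X (algebraMap ℤ_[p] (ball p)))).trans (DFunLike.congr_fun (aeval_unique hε) f)

variable (p) in
/-- The constant coefficient, as a homomorphism of `ℤ_p`-algebras. -/
noncomputable def constantCoeffAlgHom : PowerSeries (ball p) →ₐ[ℤ_[p]] ball p :=
  { constantCoeff with commutes' := fun r => by simp [PowerSeries.algebraMap_apply] }

variable (p) in
/-- The inclusion of constants, as a homomorphism of `ℤ_p`-algebras. -/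
noncomputable def constAlgHom : ball p →ₐ[ℤ_[p]] PowerSeries (ball p) :=
  { C with commutes' := fun r => by simp [PowerSeries.algebraMap_apply] }

theorem constantCoeff_aeval {x : PowerSeries (ball p)} (hx : HasEval x) {y : ball p}
    (hy : HasEval y) (h : constantCoeff x = y) (f : PowerSeries ℤ_[p]) :
    constantCoeff (aeval hx f) = aeval hy f :=
  algHom_aeval (ε := constantCoeffAlgHom p)
    (WithPiTopology.continuous_constantCoeff (ball p)) hx hy h f

theorem aeval_C {y : ball p} (hy : HasEval y) (hx : HasEval (C y)) (f : PowerSeries ℤ_[p]) :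
    aeval hx f = C (aeval hy f) :=
  (algHom_aeval (ε := constAlgHom p) WithPiTopology.continuous_C hy hx rfl f).symm

/-- Substitution in power series over the ring of integers of `ℂ_p`, as a homomorphism of
`ℤ_p`-algebras. -/
noncomputable def ballSubst {a : PowerSeries (ball p)} (ha : HasSubst a) :
    PowerSeries (ball p) →ₐ[ℤ_[p]] PowerSeries (ball p) :=
  (substAlgHom ha).restrictScalars ℤ_[p]

theorem ballSubst_apply {a : PowerSeries (ball p)} (ha : HasSubst a) (f : PowerSeries (ball p)) :
    ballSubst ha f = f.subst a := by
  rw [← coe_substAlgHom ha]; rfl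

theorem subst_aeval {a : PowerSeries (ball p)} (ha : HasSubst a) {x y : PowerSeries (ball p)}
    (hx : HasEval x) (hy : HasEval y) (h : x.subst a = y) (f : PowerSeries ℤ_[p]) :
    (aeval hx f).subst a = aeval hy f := by
  have hc : Continuous (ballSubst ha) :=
    (continuous_subst ha).congr fun g => (ballSubst_apply ha g).symm
  rw [← ballSubst_apply ha]
  exact algHom_aeval hc hx hy (by rw [ballSubst_apply, h]) f

theorem hasEval_twist (ζ : rootsOfUnity p (ball p)) :
    HasEval (C ((ζ : (ball p)ˣ) : ball p) * (1 + X) - 1) :=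
  hasEval_powerSeries (by simpa using norm_coe_sub_one_lt_one ζ)

/-- Translation by the point `ζ - 1` of the multiplicative formal group, `ζ ^ p = 1`: the
substitution of `ζ (1 + T) - 1` for `T`. -/
noncomputable def twist (ζ : rootsOfUnity p (ball p)) :
    PowerSeries ℤ_[p] →ₐ[ℤ_[p]] PowerSeries (ball p) :=
  aeval (hasEval_twist ζ)

theorem twist_X (ζ : rootsOfUnity p (ball p)) :
    twist ζ X = C ((ζ : (ball p)ˣ) : ball p) * (1 + X) - 1 :=
  aeval_X _

theorem twist_one_add_X (ζ : rootsOfUnity p (ball p)) :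
    twist ζ (1 + X) = C ((ζ : (ball p)ˣ) : ball p) * (1 + X) := by
  rw [map_add, map_one, twist_X]
  ring

theorem continuous_twist (ζ : rootsOfUnity p (ball p)) : Continuous (twist ζ) :=
  continuous_aeval _

theorem twist_C (ζ : rootsOfUnity p (ball p)) (a : ℤ_[p]) :
    twist ζ (C a) = C (algebraMap ℤ_[p] (ball p) a) :=
  ((twist ζ).commutes a).trans (PowerSeries.algebraMap_apply ..)

theorem constantCoeff_twist (ζ : rootsOfUnity p (ball p)) (f : PowerSeries ℤ_[p]) :
    constantCoeff (twist ζ f) = aeval (hasEval p (norm_coe_sub_one_lt_one ζ)) f :=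
  constantCoeff_aeval _ _ (by simp) f

/-- The derivation `(1 + T) d/dT` is invariant under translation. -/
theorem mulDeriv_twist (ζ : rootsOfUnity p (ball p)) (f : PowerSeries ℤ_[p]) :
    mulDeriv (twist ζ f) = twist ζ (mulDeriv f) := by
  have h1 : Continuous fun f : PowerSeries ℤ_[p] => mulDeriv (twist ζ f) :=
    continuous_mulDeriv.comp (continuous_twist ζ)
  have h2 : Continuous fun f : PowerSeries ℤ_[p] => twist ζ (mulDeriv f) :=
    (continuous_twist ζ).comp continuous_mulDeriv
  refine congrFun ((WithPiTopology.denseRange_toPowerSeries ℤ_[p]).equalizer h1 h2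
    (funext fun P => ?_)) f
  simp only [Function.comp_apply]
  induction P using Polynomial.induction_on' with
  | add P Q hP hQ =>
    rw [Polynomial.coe_add, map_add, mulDeriv_add, hP, hQ, mulDeriv_add, map_add]
  | monomial n a =>
    rw [Polynomial.coe_monomial, monomial_eq_C_mul_X_pow, map_mul, twist_C, mulDeriv_C_mul,
      mulDeriv_C_mul, map_mul, twist_C, map_pow]
    congr 1
    simp only [mulDeriv, derivative_pow, derivative_X, mul_one, map_mul, twist_one_add_X, map_pow,
      map_natCast]
    have : derivative (ball p) (twist ζ X) = C ((ζ : (ball p)ˣ) : ball p) := by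
      rw [twist_X]
      simp
    rw [this]
    ring

theorem iterate_mulDeriv_twist (ζ : rootsOfUnity p (ball p)) (f : PowerSeries ℤ_[p]) (k : ℕ) :
    mulDeriv^[k] (twist ζ f) = twist ζ (mulDeriv^[k] f) := by
  induction k generalizing f with
  | zero => rfl
  | succ k ih => rw [Function.iterate_succ_apply, mulDeriv_twist, ih]; rfl

/-- The substitution `T ↦ (1 + T) ^ p - 1`. -/
noncomputable def frob (f : PowerSeries ℤ_[p]) : PowerSeries ℤ_[p] :=
  f.subst ((1 + X) ^ p - 1 : PowerSeries ℤ_[p])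

variable (p) in
theorem hasSubst_frob : HasSubst ((1 + X) ^ p - 1 : PowerSeries ℤ_[p]) :=
  hasSubst_sub_one (constantCoeff_one_add_X_pow p)

/-- The series in `(1 + T) ^ p - 1` are fixed by all the translations. -/
theorem twist_frob (ζ : rootsOfUnity p (ball p)) (f : PowerSeries ℤ_[p]) :
    twist ζ (frob f) = map (algebraMap ℤ_[p] (ball p)) (frob f) := by
  have h1 : twist ζ ((1 + X) ^ p - 1 : PowerSeries ℤ_[p]) = (1 + X) ^ p - 1 := by
    rw [map_sub, map_pow, twist_one_add_X, map_one, mul_pow, ← map_pow, coe_pow_eq_one, map_one,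
      one_mul]
  have h2 : HasEval ((1 + X) ^ p - 1 : PowerSeries (ball p)) := hasEval_powerSeries (by simp)
  rw [frob, ← aeval_X_eq_map, aeval_subst hasEval_X (hasSubst_frob p) h2 (by
    rw [aeval_X_eq_map]; simp)]
  exact aeval_subst _ (hasSubst_frob p) h2 h1 f

/-- The action of a root of unity on `(1 + T) ^ a` depends on `a` modulo `p`. -/
theorem twist_binomialSeries (ζ : rootsOfUnity p (ball p)) (n : ℕ) (b : ℤ_[p]) :
    twist ζ (binomialSeries ℤ_[p] (n + p * b)) =
      C (((ζ : (ball p)ˣ) : ball p) ^ n) *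
        map (algebraMap ℤ_[p] (ball p)) (binomialSeries ℤ_[p] (n + p * b)) := by
  have h : binomialSeries ℤ_[p] (p * b) = frob (binomialSeries ℤ_[p] b) := by
    rw [frob, binomialSeries_subst_one_add_X_pow, binomialSeries_natCast_mul]
  rw [binomialSeries_add, map_mul, map_mul, h, twist_frob, binomialSeries_nat, map_pow,
    twist_one_add_X, mul_pow, map_pow, map_pow, map_add, map_one, map_X, mul_assoc]

/-- Translation by `ζ - 1` after multiplication by `a` is multiplication by `a` after translation by
`ζ ^ a - 1`; here `a = n + p b`, so that `ζ ^ a = ζ ^ n`. -/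
theorem twist_subst_binomialSeries (ζ : rootsOfUnity p (ball p)) (n : ℕ) (b : ℤ_[p])
    (f : PowerSeries ℤ_[p]) :
    twist ζ (f.subst (binomialSeries ℤ_[p] (n + p * b) - 1)) =
      (twist (ζ ^ n) f).subst
        (map (algebraMap ℤ_[p] (ball p)) (binomialSeries ℤ_[p] (n + p * b)) - 1) := by
  set B := binomialSeries ℤ_[p] (n + p * b) with hB
  have hB0 : constantCoeff B = 1 := binomialSeries_constantCoeff _
  have hB1 : constantCoeff (map (algebraMap ℤ_[p] (ball p)) B) = 1 := by
    rw [constantCoeff_map, hB0, map_one]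
  have hs := hasSubst_sub_one hB1
  have he : HasEval (C (((ζ : (ball p)ˣ) : ball p) ^ n) *
        map (algebraMap ℤ_[p] (ball p)) B - 1) := hasEval_powerSeries (by
    have := norm_coe_sub_one_lt_one (ζ ^ n)
    simpa [hB1] using this)
  refine (aeval_subst _ (hasSubst_sub_one hB0) he ?_ f).trans
    (subst_aeval hs _ he ?_ f).symm
  · change twist ζ (B - 1) = _
    rw [map_sub, map_one, hB, twist_binomialSeries]
  · rw [sub_one_subst hs, subst_mul hs, one_add_X_subst_sub_one hB1, subst_C]
    simp only [Subgroup.coe_pow, Units.val_pow_eq_pow_val]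
    rfl

end PadicComplex

/-! ### The trace relation -/

namespace PadicComplex

open PowerSeries

variable {p : ℕ} [hp : Fact p.Prime]

theorem mulDeriv_frob (f : PowerSeries ℤ_[p]) :
    mulDeriv (frob f) = C (p : ℤ_[p]) * frob (mulDeriv f) :=
  mulDeriv_subst_sub_one (constantCoeff_one_add_X_pow p) (mulDeriv_one_add_X_pow p) f

theorem iterate_mulDeriv_frob (f : PowerSeries ℤ_[p]) (k : ℕ) :
    mulDeriv^[k] (frob f) = C ((p : ℤ_[p]) ^ k) * frob (mulDeriv^[k] f) :=
  iterate_mulDeriv_subst_sub_one (constantCoeff_one_add_X_pow p) (mulDeriv_one_add_X_pow p) f k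

theorem frob_mul (f g : PowerSeries ℤ_[p]) : frob (f * g) = frob f * frob g :=
  subst_mul (hasSubst_frob p) f g

theorem frob_C (a : ℤ_[p]) : frob (C a) = C a := subst_C a

theorem constantCoeff_frob (f : PowerSeries ℤ_[p]) : constantCoeff (frob f) = constantCoeff f :=
  constantCoeff_subst_of_constantCoeff_zero (by simp) f

/-- If a series `τ = T + ⋯` has norm `τ((1 + T) ^ p - 1)`, so does `τ((1 + T) ^ a - 1)` for every
unit `a`, since `ζ ↦ ζ ^ a` permutes the `p`-th roots of unity. Hence the same relation holds, up
to a constant, for the quotient `q` of the two series, and taking logarithmic derivatives gives a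
trace relation. -/
theorem sum_twist_eq_of_prod_twist_eq (hcard : Nat.card (rootsOfUnity p (ball p)) = p)
    {τ : PowerSeries ℤ_[p]} (hτ1 : coeff 1 τ = 1)
    (hτ : ∏ ζ : rootsOfUnity p (ball p), twist ζ τ = map (algebraMap ℤ_[p] (ball p)) (frob τ))
    (a : ℤ_[p]ˣ) {q H : PowerSeries ℤ_[p]} (hq0 : constantCoeff q = 1)
    (hq : C (a : ℤ_[p]) * τ * q = τ.subst (binomialSeries ℤ_[p] (a : ℤ_[p]) - 1))
    (hH : mulDeriv q = H * q) :
    ∑ ζ : rootsOfUnity p (ball p), twist ζ H =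
      (p : PowerSeries (ball p)) * map (algebraMap ℤ_[p] (ball p)) (frob H) := by
  set ι := map (algebraMap ℤ_[p] (ball p)) with hι
  set B := binomialSeries ℤ_[p] (a : ℤ_[p]) with hB
  have hB0 : constantCoeff B = 1 := binomialSeries_constantCoeff _
  have hB1 : constantCoeff (ι B) = 1 := by rw [hι, constantCoeff_map, hB0, map_one]
  have hs := hasSubst_sub_one hB0
  have hs1 := hasSubst_sub_one hB1
  have hιinj : Function.Injective ι := PowerSeries.map_injective _ (algebraMap_injective p)
  -- `ζ ^ a = ζ ^ n` for a natural number `n` congruent to `a` modulo `p`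
  obtain ⟨n, b, hn⟩ : ∃ (n : ℕ) (b : ℤ_[p]), (a : ℤ_[p]) = n + p * b := by
    have h := PadicInt.sub_zmodRepr_mem (a : ℤ_[p])
    rw [PadicInt.maximalIdeal_eq_span_p, Ideal.mem_span_singleton] at h
    obtain ⟨b, hb⟩ := h
    exact ⟨_, b, by rw [← hb]; ring⟩
  have hpn : (Nat.card (rootsOfUnity p (ball p))).Coprime n := by
    rw [hcard, Nat.Prime.coprime_iff_not_dvd hp.out]
    rintro ⟨m, rfl⟩
    have hu := a.isUnit
    rw [hn] at hu
    refine PadicInt.p_nonunit (p := p) (isUnit_of_dvd_unit ⟨m + b, ?_⟩ hu)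
    push_cast
    ring
  -- the norm of `τ((1 + T) ^ a - 1)`
  have h1 : ∏ ζ : rootsOfUnity p (ball p), twist ζ (τ.subst (B - 1)) =
      ι (frob (τ.subst (B - 1))) := by
    have e : ∀ ζ : rootsOfUnity p (ball p), twist ζ (τ.subst (B - 1)) =
        ballSubst hs1 (twist (powCoprime hpn ζ) τ) := by
      intro ζ
      rw [ballSubst_apply, hB, hn, twist_subst_binomialSeries, powCoprime_apply, hι]
    simp only [e]
    rw [← map_prod, Equiv.prod_comp (powCoprime hpn) fun ζ => twist ζ τ, hτ, ballSubst_apply]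
    have h2 : (ι (frob τ)).subst (ι (B - 1)) = ι ((frob τ).subst (B - 1)) :=
      (map_subst hs (frob τ)).symm
    rw [map_sub, map_one] at h2
    rw [h2, frob, frob, subst_comp_subst_apply (hasSubst_frob p) hs,
      subst_comp_subst_apply hs (hasSubst_frob p), sub_one_subst hs, subst_pow hs,
      one_add_X_subst_sub_one hB0, sub_one_subst (hasSubst_frob p), hB,
      binomialSeries_subst_one_add_X_pow]
  have hφ : ι (frob τ) ≠ 0 := by
    intro h
    have h0 : frob τ = 0 := hιinj (h.trans (map_zero _).symm)
    have h2 := congrArg constantCoeff (mulDeriv_frob τ)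
    rw [h0, map_mul, constantCoeff_frob, constantCoeff_C] at h2
    rw [constantCoeff_mulDeriv τ, hτ1, mulDeriv, map_zero, mul_zero, map_zero, mul_one] at h2
    exact hp.out.ne_zero (by exact_mod_cast h2.symm)
  -- the norm of `q` is `q((1 + T) ^ p - 1)` up to a constant
  obtain ⟨c, hc⟩ : ∃ c : ball p, C c * ∏ ζ : rootsOfUnity p (ball p), twist ζ q =
      C (algebraMap ℤ_[p] (ball p) a) * ι (frob q) := by
    refine ⟨algebraMap ℤ_[p] (ball p) a ^ p, mul_left_cancel₀ hφ ?_⟩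
    rw [← hq] at h1
    simp only [map_mul, Finset.prod_mul_distrib, twist_C, frob_mul, frob_C, hτ] at h1
    rw [Finset.prod_const, Finset.card_univ, ← Nat.card_eq_fintype_card, hcard] at h1
    rw [map_pow]
    rw [hι, map_C] at h1
    rw [hι]
    linear_combination h1
  -- logarithmic derivatives
  have h4 := congrArg mulDeriv hc
  rw [mulDeriv_C_mul, mulDeriv_C_mul, mulDeriv_prod _ (h := fun ζ => twist ζ H) fun ζ _ => by
      rw [mulDeriv_twist, hH, map_mul],
    hι, mulDeriv_map, mulDeriv_frob, hH, frob_mul, map_mul, map_mul, map_C, map_natCast, ← hι] at h4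
  have h5 : C (algebraMap ℤ_[p] (ball p) a) * ι (frob q) ≠ 0 := by
    refine mul_ne_zero (fun h => a.ne_zero ?_) fun h => ?_
    · exact algebraMap_injective p
        ((C_injective (h.trans (map_zero C).symm)).trans (map_zero _).symm)
    · have := congrArg constantCoeff h
      rw [hι, constantCoeff_map, constantCoeff_frob, hq0, map_one, map_zero] at this
      exact one_ne_zero this
  refine mul_left_cancel₀ h5 ?_
  rw [map_natCast] at h4
  linear_combination h4 - (∑ ζ : rootsOfUnity p (ball p), twist ζ H) * hc

/-- The trace relation says that the measure with Mahler transform `H` is scaled by `p ^ k` when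
integrating `x ^ k` over `p ℤ_p` instead of `ℤ_p`. -/
theorem mahlerFunctional_pow_mul_indicatorMul
    (hcard : Nat.card (rootsOfUnity p (ball p)) = p) {H : PowerSeries ℤ_[p]}
    (hH : ∑ ζ : rootsOfUnity p (ball p), twist ζ H =
      (p : PowerSeries (ball p)) * map (algebraMap ℤ_[p] (ball p)) (frob H)) (k : ℕ) :
    mahlerFunctional H (ContinuousMap.id ℤ_[p] ^ k * indicatorMul p) =
      (p : ℤ_[p]) ^ k * constantCoeff (mulDeriv^[k] H) := by
  have h1 : ∑ ζ : rootsOfUnity p (ball p), mulDeriv^[k] (twist ζ H) =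
      mulDeriv^[k] (C (p : ball p) * map (algebraMap ℤ_[p] (ball p)) (frob H)) := by
    rw [map_natCast, ← hH]
    clear hH
    induction k generalizing H with
    | zero => rfl
    | succ k ih =>
      simp only [Function.iterate_succ_apply, mulDeriv_sum, mulDeriv_twist]
      simpa only [mulDeriv_twist, Function.iterate_succ_apply] using ih (H := mulDeriv H)
  have h2 := congrArg constantCoeff h1
  rw [map_sum] at h2
  simp only [iterate_mulDeriv_twist, constantCoeff_twist] at h2
  rw [← mahlerFunctional_indicatorMul hcard, iterate_mulDeriv_C_mul, iterate_mulDeriv_map,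
    iterate_mulDeriv_frob, map_mul, constantCoeff_C, constantCoeff_map, map_mul, constantCoeff_C,
    constantCoeff_frob] at h2
  rw [mahlerFunctional_pow_mul]
  have hp0 : (p : ball p) ≠ 0 := by
    rw [← map_natCast (algebraMap ℤ_[p] (ball p)), Ne, ← map_zero (algebraMap ℤ_[p] (ball p)),
      (algebraMap_injective p).eq_iff]
    exact_mod_cast hp.out.ne_zero
  exact algebraMap_injective p (mul_left_cancel₀ hp0 h2)

end PadicComplex

/-! ### The formal group as a form of the multiplicative group -/

namespace FormalGroup

section Parameter

variable {R : Type*} [CommRing R] (F : FormalGroup R)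

/-- `τ` is the inverse, for composition, of the isomorphism `g - 1` from the formal group to the
multiplicative formal group: the coordinate `t` as a series in the coordinate `T` of the
multiplicative group. -/
structure IsInverseParam (g τ : PowerSeries R) : Prop where
  constantCoeff_char : PowerSeries.constantCoeff g = 1
  invDeriv_char : F.invDeriv g = g
  constantCoeff : PowerSeries.constantCoeff τ = 0
  subst_left : τ.subst (g - 1) = PowerSeries.X
  subst_right : g.subst τ = 1 + PowerSeries.X

variable {F}

theorem exists_isInverseParam {g : PowerSeries R} (hg0 : PowerSeries.constantCoeff g = 1)
    (hg : F.invDeriv g = g) : ∃ τ, F.IsInverseParam g τ := by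
  have h0 := PowerSeries.constantCoeff_sub_one hg0
  have h1 : PowerSeries.coeff 1 (g - 1) = 1 := by
    have := congrArg PowerSeries.constantCoeff hg
    rw [invDeriv, map_mul, constantCoeff_partialTwo, one_mul,
      ← PowerSeries.coeff_zero_eq_constantCoeff_apply, PowerSeries.coeff_derivative, hg0] at this
    simpa [PowerSeries.coeff_one] using this
  have hu : IsUnit (PowerSeries.coeff 1 (g - 1)) := by rw [h1]; exact isUnit_one
  refine ⟨(g - 1).substInvOfIsUnit hu, hg0, hg, by simp,
    PowerSeries.subst_substInvOfIsUnit_left _ h0 hu, ?_⟩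
  have h := PowerSeries.subst_substInvOfIsUnit_right _ h0 hu
  rw [PowerSeries.sub_one_subst (PowerSeries.HasSubst.substInvOfIsUnit _ hu)] at h
  rw [← h]
  ring

namespace IsInverseParam

variable {g τ : PowerSeries R} (h : F.IsInverseParam g τ)

include h

theorem hasSubst : PowerSeries.HasSubst τ :=
  PowerSeries.HasSubst.of_constantCoeff_zero' h.constantCoeff

theorem hasSubst_char : PowerSeries.HasSubst (g - 1) :=
  PowerSeries.hasSubst_sub_one h.constantCoeff_char

/-- The isomorphism with the multiplicative group matches the invariant derivations. -/
theorem mulDeriv_subst (f : PowerSeries R) :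
    PowerSeries.mulDeriv (f.subst τ) = (F.invDeriv f).subst τ := by
  have h1 : F.partialTwo.subst τ * (PowerSeries.derivative R g).subst τ = 1 + PowerSeries.X := by
    rw [← PowerSeries.subst_mul h.hasSubst, ← h.subst_right]
    exact congrArg _ h.invDeriv_char
  have h2 := congrArg (PowerSeries.derivative R) h.subst_right
  rw [PowerSeries.derivative_subst h.hasSubst, map_add, Derivation.map_one_eq_zero,
    PowerSeries.derivative_X, _root_.zero_add] at h2
  rw [PowerSeries.mulDeriv, PowerSeries.derivative_subst h.hasSubst, invDeriv,
    PowerSeries.subst_mul h.hasSubst]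
  linear_combination (-(PowerSeries.derivative R f).subst τ * PowerSeries.derivative R τ) * h1 +
    F.partialTwo.subst τ * (PowerSeries.derivative R f).subst τ * h2

theorem iterate_mulDeriv_subst (f : PowerSeries R) (k : ℕ) :
    PowerSeries.mulDeriv^[k] (f.subst τ) = (F.invDeriv^[k] f).subst τ := by
  induction k generalizing f with
  | zero => rfl
  | succ k ih => rw [Function.iterate_succ_apply, h.mulDeriv_subst, ih]; rfl

theorem constantCoeff_iterate_mulDeriv_subst (f : PowerSeries R) (k : ℕ) :
    PowerSeries.constantCoeff (PowerSeries.mulDeriv^[k] (f.subst τ)) = F.beta k f := by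
  rw [h.iterate_mulDeriv_subst,
    PowerSeries.constantCoeff_subst_of_constantCoeff_zero h.constantCoeff, beta]

theorem coeff_one : PowerSeries.coeff 1 τ = 1 := by
  have h1 := h.constantCoeff_iterate_mulDeriv_subst PowerSeries.X 1
  rw [PowerSeries.subst_X h.hasSubst, beta_one, PowerSeries.derivative_X, map_one,
    Function.iterate_one, PowerSeries.constantCoeff_mulDeriv] at h1
  exact h1

theorem mem_dualTate [IsAddTorsionFree R] [F.IsComm] : g ∈ F.dualTate :=
  F.mem_dualTate_of_invDeriv_eq (c := 1) h.constantCoeff_char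
    (by rw [h.invDeriv_char, map_one, one_mul])

/-- Multiplication by `n` on the formal group becomes `T ↦ (1 + T) ^ n - 1`. -/
theorem subst_nSeries [IsAddTorsionFree R] [F.IsComm] (n : ℕ) :
    (F.nSeries n).subst τ = τ.subst ((1 + PowerSeries.X) ^ n - 1 : PowerSeries R) := by
  have hn : PowerSeries.HasSubst (F.nSeries n) :=
    PowerSeries.HasSubst.of_constantCoeff_zero' (F.constantCoeff_nSeries n)
  have h1 : F.nSeries n = τ.subst (g ^ n - 1) := by
    rw [← F.subst_nSeries_of_mem_dualTate h.mem_dualTate n, ← PowerSeries.sub_one_subst hn,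
      ← PowerSeries.subst_comp_subst_apply h.hasSubst_char hn, h.subst_left,
      PowerSeries.subst_X hn]
  have h2 : PowerSeries.HasSubst (g ^ n - 1) :=
    PowerSeries.hasSubst_sub_one
      (by rw [map_pow, h.constantCoeff_char, one_pow])
  rw [h1, PowerSeries.subst_comp_subst_apply h2 h.hasSubst, PowerSeries.sub_one_subst h.hasSubst,
    PowerSeries.subst_pow h.hasSubst, h.subst_right]

theorem map {S : Type*} [CommRing S] (e : R →+* S) :
    (F.map e).IsInverseParam (PowerSeries.map e g) (PowerSeries.map e τ) where
  constantCoeff_char := by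
    rw [PowerSeries.constantCoeff_map, h.constantCoeff_char, map_one]
  invDeriv_char := by rw [map_invDeriv, h.invDeriv_char]
  constantCoeff := by rw [PowerSeries.constantCoeff_map, h.constantCoeff, map_zero]
  subst_left := by
    have h1 := PowerSeries.map_subst h.hasSubst_char (h := e) τ
    rw [map_sub, map_one] at h1
    refine h1.symm.trans ?_
    rw [h.subst_left]
    exact PowerSeries.map_X e
  subst_right := by
    have h1 := PowerSeries.map_subst h.hasSubst (h := e) g
    refine h1.symm.trans ?_
    rw [h.subst_right, map_add, map_one]
    congr 1
    exact PowerSeries.map_X e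

end IsInverseParam

end Parameter

section Norm

open PadicComplex PowerSeries

variable {p : ℕ} [hp : Fact p.Prime] {F : FormalGroup ℤ_[p]}

theorem aeval_zero_eq_constantCoeff {R S : Type*} [CommRing R] [CommRing S] [UniformSpace R]
    [UniformSpace S] [IsTopologicalRing R] [IsUniformAddGroup R] [IsUniformAddGroup S]
    [IsTopologicalRing S] [CompleteSpace S] [T2Space S] [IsLinearTopology S S] [Algebra R S]
    [ContinuousSMul R S] (h0 : HasEval (0 : S)) (f : PowerSeries R) :
    aeval h0 f = algebraMap R S (PowerSeries.constantCoeff f) := by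
  refine (hasSum_aeval h0 f).unique ?_
  have := hasSum_single (f := fun n => coeff n f • (0 : S) ^ n) 0 fun n hn => by
    rw [zero_pow hn, smul_zero]
  simpa [Algebra.smul_def] using this

section Point

variable {g τ : PowerSeries ℤ_[p]} (h : F.IsInverseParam g τ)

include h

theorem norm_aeval_char_sub_one_lt_one {c : ball p} (hc : ‖c‖ < 1) :
    ‖aeval (hasEval p hc) (g - 1)‖ < 1 := by
  obtain ⟨w, hw⟩ : X ∣ g - 1 := X_dvd_iff.2 (constantCoeff_sub_one h.constantCoeff_char)
  rw [hw, map_mul, aeval_X]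
  exact (norm_mul_le _ _).trans_lt <|
    (mul_le_of_le_one_right (norm_nonneg _) (ball_norm_le_one p _)).trans_lt hc

/-- The inverse parameter recovers a point of the formal group from its image in the multiplicative
group. -/
theorem aeval_inverseParam {c : ball p} (hc : ‖c‖ < 1)
    (he : HasEval (aeval (hasEval p hc) g - 1)) : aeval he τ = c := by
  rw [← aeval_subst (hasEval p hc) h.hasSubst_char he (by rw [map_sub, map_one]), h.subst_left,
    aeval_X]

theorem aeval_char_pow_eq_one [F.IsComm] {c : ball p} (hc : ‖c‖ < 1)
    (h0 : aeval (hasEval p hc) (F.nSeries p) = 0) : aeval (hasEval p hc) g ^ p = 1 := by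
  have hn : PowerSeries.HasSubst (F.nSeries p) :=
    PowerSeries.HasSubst.of_constantCoeff_zero' (F.constantCoeff_nSeries p)
  rw [← map_pow, ← F.subst_nSeries_of_mem_dualTate h.mem_dualTate p,
    aeval_subst (hasEval p hc) hn HasEval.zero h0, aeval_zero_eq_constantCoeff,
    h.constantCoeff_char, map_one]

/-- Translation by `c` on the formal group becomes multiplication by `g(c)` on the multiplicative
group. -/
theorem ballTranslate_subst [F.IsComm] {c : ball p} (hc : ‖c‖ < 1) (ζ : rootsOfUnity p (ball p))
    (hζ : ((ζ : (ball p)ˣ) : ball p) = aeval (hasEval p hc) g) :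
    (F.ballTranslate c hc).subst (PowerSeries.map (algebraMap ℤ_[p] (ball p)) τ) = twist ζ τ := by
  set ι := PowerSeries.map (algebraMap ℤ_[p] (ball p)) with hι
  have hpair := hasEval_pair (x := (X : PowerSeries (ball p))) (y := C c) (by simp)
    (by simpa using hc)
  have hX : ∀ s : Fin 2, MvPowerSeries.aeval (R := ℤ_[p]) hpair (MvPowerSeries.X s) =
      ![X, C c] s := by
    intro s
    rw [← MvPolynomial.coe_X, MvPowerSeries.aeval_coe, MvPolynomial.aeval_X]
  have hY : HasEval (F.ballTranslate c hc) := hasEval_powerSeries (by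
    have h1 := F.map_mk_ballTranslate c hc
    have h2 := congrArg PowerSeries.constantCoeff h1
    rw [constantCoeff_map, constantCoeff_X, Ideal.Quotient.eq_zero_iff_mem, mem_ballIdeal] at h2
    exact h2)
  have hCc : HasEval (C c : PowerSeries (ball p)) := hasEval_powerSeries (by simpa using hc)
  -- `g(t +_F c) = g(t) g(c)`
  have h1 : aeval hY g = ι g * C ((ζ : (ball p)ˣ) : ball p) := by
    rw [← mvAeval_subst hpair F.hasSubst hY rfl, h.mem_dualTate.2, map_mul,
      mvAeval_subst hpair (HasSubst.X 0) hasEval_X (hX 0),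
      mvAeval_subst hpair (HasSubst.X 1) hCc (hX 1), aeval_X_eq_map,
      aeval_C (hasEval p hc) hCc, hζ]
  have hτ' : HasSubst (ι τ) := (h.map (algebraMap ℤ_[p] (ball p))).hasSubst
  have h2 : aeval hY (g - 1) = C ((ζ : (ball p)ˣ) : ball p) * ι g - 1 := by
    rw [map_sub, map_one, h1, mul_comm]
  have hE : HasEval (C ((ζ : (ball p)ˣ) : ball p) * ι g - 1) := hasEval_powerSeries (by
    rw [map_sub, map_mul, constantCoeff_C, hι, constantCoeff_map, h.constantCoeff_char, map_one,
      map_one, mul_one]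
    exact norm_coe_sub_one_lt_one ζ)
  -- hence `t +_F c = τ(g(c) g(t) - 1)`, where `t` is to be replaced by `τ`
  have h3 : aeval hE τ = F.ballTranslate c hc := by
    rw [← aeval_subst hY h.hasSubst_char hE h2, h.subst_left, aeval_X]
  rw [← h3]
  refine subst_aeval hτ' hE (hasEval_twist ζ) ?_ τ
  rw [sub_one_subst hτ', subst_mul hτ', subst_C,
    (h.map (algebraMap ℤ_[p] (ball p))).subst_right]
  rfl

end Point

/-- The Ando condition in the coordinate of the multiplicative group: the series `τ` has norm
`τ((1 + T) ^ p - 1)`. -/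
theorem AndoCondition.prod_twist [F.IsComm] (hF : F.HasHeightOne) (hAndo : F.AndoCondition)
    {g τ : PowerSeries ℤ_[p]} (h : F.IsInverseParam g τ) :
    Nat.card (rootsOfUnity p (ball p)) = p ∧
      ∏ ζ : rootsOfUnity p (ball p), twist ζ τ =
        PowerSeries.map (algebraMap ℤ_[p] (ball p)) (frob τ) := by
  obtain ⟨T, hT0, hTcard, hTprod, -⟩ := AndoCondition.exists_finset hF hAndo
  let z : T → rootsOfUnity p (ball p) := fun c =>
    haveI : NeZero p := ⟨hp.out.ne_zero⟩
    rootsOfUnity.mkOfPowEq _ (aeval_char_pow_eq_one h c.1.2 (hT0 c.1 c.2))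
  have hz : ∀ c : T, ((z c : (ball p)ˣ) : ball p) = aeval (hasEval p c.1.2) g := fun c => rfl
  -- a point is recovered from its image by evaluating `τ`
  have hinj : Function.Injective z := by
    intro c d hcd
    have e : aeval (hasEval p c.1.2) g = aeval (hasEval p d.1.2) g := by rw [← hz, ← hz, hcd]
    have hc : HasEval (aeval (hasEval p c.1.2) g - 1) := hasEval p (by
      simpa using norm_aeval_char_sub_one_lt_one h c.1.2)
    have hd : HasEval (aeval (hasEval p d.1.2) g - 1) := e ▸ hc
    refine Subtype.ext (Subtype.ext ?_)
    rw [← aeval_inverseParam h c.1.2 hc, ← aeval_inverseParam h d.1.2 hd]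
    congr! 2
    rw [e]
  -- there are at most `p` roots of unity, and `p` points of `F[p]`
  have hle : Nat.card (rootsOfUnity p (ball p)) ≤ p := by
    have : NeZero p := ⟨hp.out.ne_zero⟩
    exact card_rootsOfUnity _ p
  have hcT : Nat.card T = p := by rw [Nat.card_eq_fintype_card, Fintype.card_coe, hTcard]
  have hcard : Nat.card (rootsOfUnity p (ball p)) = p :=
    hle.antisymm (hcT.symm.le.trans (Nat.card_le_card_of_injective z hinj))
  have hbij : Function.Bijective z := by
    refine (Fintype.bijective_iff_injective_and_card z).2 ⟨hinj, ?_⟩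
    rw [← Nat.card_eq_fintype_card, ← Nat.card_eq_fintype_card, hcT, hcard]
  refine ⟨hcard, ?_⟩
  have hτ' := (h.map (algebraMap ℤ_[p] (ball p))).hasSubst
  have h1 := congrArg (ballSubst hτ') hTprod
  rw [map_prod, ballSubst_apply] at h1
  have h2 : (PowerSeries.map (algebraMap ℤ_[p] (ball p)) (F.nSeries p)).subst
      (PowerSeries.map (algebraMap ℤ_[p] (ball p)) τ) =
        PowerSeries.map (algebraMap ℤ_[p] (ball p)) ((F.nSeries p).subst τ) :=
    (map_subst h.hasSubst (F.nSeries p)).symm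
  rw [h2, h.subst_nSeries] at h1
  rw [frob, ← h1, ← Function.Bijective.prod_comp hbij, ← Finset.prod_coe_sort T]
  refine Finset.prod_congr rfl fun c _ => ?_
  rw [ballSubst_apply, ballTranslate_subst h c.1.2 (z c) (hz c)]

end Norm

end FormalGroup

/-! ### Measures on `ℤ_p^×` -/

section Measure

variable {p : ℕ} [hp : Fact p.Prime]

open PadicComplex PowerSeries

/-- Extension by zero of a function on `ℤ_p^×` to `ℤ_p`. -/
noncomputable def unitsExtend : C(ℤ_[p]ˣ, ℤ_[p]) →L[ℤ_[p]] C(ℤ_[p], ℤ_[p]) :=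
  have hinj : Function.Injective (Units.val : ℤ_[p]ˣ → ℤ_[p]) := Units.val_injective
  have hcont (φ : C(ℤ_[p]ˣ, ℤ_[p])) : Continuous (Function.extend Units.val φ 0) := by
    rw [continuous_iff_continuousAt]
    intro x
    by_cases hx : IsUnit x
    · obtain ⟨u, rfl⟩ := hx
      have e : Function.extend Units.val φ 0 ∘ Units.val = φ :=
        funext fun v => hinj.extend_apply ..
      rw [← Units.isOpenEmbedding_val.continuousAt_iff, e]
      exact φ.continuous.continuousAt
    · refine (continuousAt_const (y := (0 : ℤ_[p]))).congr ?_
      -- the extension vanishes on the open set `p ℤ_p`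
      filter_upwards [(isOpen_lt continuous_norm continuous_const).mem_nhds
        (PadicInt.not_isUnit_iff.1 hx)] with y hy
      rw [Function.extend_apply', Pi.zero_apply]
      rintro ⟨u, rfl⟩
      exact hy.ne (PadicInt.isUnit_iff.1 u.isUnit)
  let L : C(ℤ_[p]ˣ, ℤ_[p]) →ₗ[ℤ_[p]] C(ℤ_[p], ℤ_[p]) :=
    { toFun := fun φ => ⟨Function.extend Units.val φ 0, hcont φ⟩
      map_add' := fun φ ψ => by
        ext x
        by_cases hx : ∃ u : ℤ_[p]ˣ, u.val = x
        · obtain ⟨u, rfl⟩ := hx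
          simp [hinj.extend_apply]
        · simp [Function.extend_apply' _ _ _ hx]
      map_smul' := fun c φ => by
        ext x
        by_cases hx : ∃ u : ℤ_[p]ˣ, u.val = x
        · obtain ⟨u, rfl⟩ := hx
          simp [hinj.extend_apply]
        · simp [Function.extend_apply' _ _ _ hx] }
  ⟨L, AddMonoidHomClass.continuous_of_bound L 1 fun φ => by
    rw [one_mul]
    refine (ContinuousMap.norm_le _ (norm_nonneg _)).2 fun x => ?_
    change ‖Function.extend Units.val φ 0 x‖ ≤ _
    by_cases hx : ∃ u : ℤ_[p]ˣ, u.val = x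
    · obtain ⟨u, rfl⟩ := hx
      rw [hinj.extend_apply]
      exact φ.norm_coe_le_norm u
    · rw [Function.extend_apply' _ _ _ hx]
      simp⟩

/-- The function `x ^ k` on `ℤ_p^×`, extended by zero, is `x ^ k` minus its restriction to
`p ℤ_p`. -/
theorem unitsExtend_padicUnitPow (k : ℕ) :
    unitsExtend (padicUnitPow p k) =
      ContinuousMap.id ℤ_[p] ^ k - ContinuousMap.id ℤ_[p] ^ k * indicatorMul p := by
  ext x
  have e : indicatorMul p x = Set.indicator {x | ‖x‖ < 1} 1 x := rfl
  rw [ContinuousMap.sub_apply, ContinuousMap.mul_apply, ContinuousMap.pow_apply,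
    ContinuousMap.id_apply, e]
  change Function.extend Units.val (padicUnitPow p k) 0 x = _
  by_cases hx : ∃ u : ℤ_[p]ˣ, u.val = x
  · obtain ⟨u, rfl⟩ := hx
    rw [Units.val_injective.extend_apply, Set.indicator_of_notMem
      (s := {x : ℤ_[p] | ‖x‖ < 1})
      (fun h : ‖(u : ℤ_[p])‖ < 1 => h.ne (PadicInt.isUnit_iff.1 u.isUnit)), mul_zero, sub_zero]
    rfl
  · have h1 : ‖x‖ < 1 := PadicInt.not_isUnit_iff.1 hx
    rw [Function.extend_apply' _ _ _ hx, Set.indicator_of_mem (s := {x : ℤ_[p] | ‖x‖ < 1}) h1,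
      Pi.one_apply, mul_one, sub_self, Pi.zero_apply]

/-- The function `x ↦ x⁻¹` on `ℤ_p^×`. -/
noncomputable def padicUnitInv (p : ℕ) [Fact p.Prime] : C(ℤ_[p]ˣ, ℤ_[p]) where
  toFun x := (x⁻¹ : ℤ_[p]ˣ)
  continuous_toFun := Units.continuous_val.comp continuous_inv

/-- The measure `x⁻¹ m` on `ℤ_p^×`, where `m` is the restriction to `ℤ_p^×` of the measure on `ℤ_p`
with Mahler transform `H`. -/
noncomputable def unitsMeasure (H : PowerSeries ℤ_[p]) : AbstractMeasure ℤ_[p]ˣ ℤ_[p] ℤ_[p] :=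
  AbstractMeasure.toCLMEquiv.symm <| (mahlerFunctional H).comp <| unitsExtend.comp
    ⟨LinearMap.mulLeft ℤ_[p] (padicUnitInv p), continuous_const.mul continuous_id⟩

/-- The factor `1 - p ^ k` comes from removing `p ℤ_p` from `ℤ_p`. -/
theorem unitsMeasure_padicUnitPow (hcard : Nat.card (rootsOfUnity p (ball p)) = p)
    {H : PowerSeries ℤ_[p]}
    (hH : ∑ ζ : rootsOfUnity p (ball p), twist ζ H =
      (p : PowerSeries (ball p)) * map (algebraMap ℤ_[p] (ball p)) (frob H)) (k : ℕ) :
    unitsMeasure H (padicUnitPow p (k + 1)) =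
      (1 - (p : ℤ_[p]) ^ k) * constantCoeff (mulDeriv^[k] H) := by
  have h1 : padicUnitInv p * padicUnitPow p (k + 1) = padicUnitPow p k := by
    ext u
    change ((u⁻¹ : ℤ_[p]ˣ) : ℤ_[p]) * (u : ℤ_[p]) ^ (k + 1) = (u : ℤ_[p]) ^ k
    rw [pow_succ', ← mul_assoc, Units.inv_mul, one_mul]
  change mahlerFunctional H (unitsExtend (padicUnitInv p * padicUnitPow p (k + 1))) = _
  rw [h1, unitsExtend_padicUnitPow, map_sub, mahlerFunctional_pow_mul_indicatorMul hcard hH,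
    ← mul_one (ContinuousMap.id ℤ_[p] ^ k), mahlerFunctional_pow_mul, mahlerFunctional_one]
  ring

end Measure

/-! ### The logarithmic derivative of `log_F(t) / t` -/

namespace PowerSeries

theorem derivative_logOf_mul {A : Type*} [CommRing A] [Algebra ℚ A] {f : PowerSeries A}
    (hf : constantCoeff f = 1) : derivative A (logOf f) * f = derivative A f := by
  have hs := hasSubst_sub_one hf
  have h1 : derivative A (log A) * (1 + X) = 1 := by
    rw [deriv_log]
    ext n
    rw [mul_add, mul_one, map_add, coeff_mk, coeff_one]
    rcases n with _ | n
    · simp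
    · rw [coeff_succ_mul_X, coeff_mk, ← map_add]
      simp [pow_succ]
  have h2 := congrArg (subst (f - 1)) h1
  rw [subst_mul hs, one_add_X_subst_sub_one hf, one_subst hs] at h2
  have h3 : derivative A (f - 1) = derivative A f := by
    rw [map_sub, Derivation.map_one_eq_zero, sub_zero]
  rw [logOf, derivative_subst hs, h3, mul_right_comm, h2, one_mul]

theorem eq_of_mulDeriv_eq {R : Type*} [CommRing R] [IsAddTorsionFree R] {f g : PowerSeries R}
    (h : mulDeriv f = mulDeriv g) (h0 : constantCoeff f = constantCoeff g) : f = g := by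
  have hu : IsUnit (1 + X : PowerSeries R) := isUnit_iff_constantCoeff.2 (by simp)
  exact derivative.ext (hu.mul_left_cancel h) h0

end PowerSeries

namespace FormalGroup

open PowerSeries

section Field

variable {K : Type*} [Field K] {E : FormalGroup K}

/-- The series `log_F(t) / t` is defined by shifting coefficients; this is no loss, as
`log_F(0) = 0`. -/
theorem X_mul_formalLogDivX : X * E.formalLogDivX = E.formalLog := by
  ext n
  rcases n with _ | n
  · simp [E.constantCoeff_formalLog]
  · rw [coeff_succ_X_mul, formalLogDivX, coeff_mk]

theorem constantCoeff_formalLogDivX : PowerSeries.constantCoeff E.formalLogDivX = 1 := by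
  rw [← coeff_zero_eq_constantCoeff_apply, formalLogDivX, coeff_mk, coeff_one_formalLog]

variable [CharZero K] {g τ : PowerSeries K} (h : E.IsInverseParam g τ)

include h

/-- `log_F` intertwines multiplication by `a` on the formal group with multiplication by `a`; in the
coordinate of the multiplicative group it is `log(1 + T)`. -/
theorem formalLog_subst_subst {a : K} {b : PowerSeries K} (hb0 : PowerSeries.constantCoeff b = 1)
    (hb : mulDeriv b = C a * b) :
    PowerSeries.subst (b - 1) (E.formalLog.subst τ : PowerSeries K) =
      C a * (E.formalLog.subst τ : PowerSeries K) := by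
  have hs := hasSubst_sub_one hb0
  have h0 : PowerSeries.constantCoeff (E.formalLog.subst τ) = 0 := by
    rw [constantCoeff_subst_of_constantCoeff_zero h.constantCoeff, E.constantCoeff_formalLog]
  have h1 : mulDeriv (E.formalLog.subst τ) = 1 := by
    rw [h.mulDeriv_subst, invDeriv_formalLog, one_subst h.hasSubst]
  refine eq_of_mulDeriv_eq ?_ ?_
  · rw [mulDeriv_subst_sub_one hb0 hb, mulDeriv_C_mul, h1, one_subst hs]
  · rw [constantCoeff_subst_of_constantCoeff_zero (by simp [hb0]), map_mul, h0, mul_zero]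

/-- The logarithmic derivative of `q = [a](t) / (a t)` is `ℓ - a ℓ ∘ [a]`, where `ℓ` is the
logarithmic derivative of `log_F(t) / t`. -/
theorem logDeriv_eq [Algebra ℚ K] {a : K} (ha : a ≠ 0) {b q H : PowerSeries K}
    (hb0 : PowerSeries.constantCoeff b = 1) (hb : mulDeriv b = C a * b)
    (hq : C a * τ * q = τ.subst (b - 1)) (hH : mulDeriv q = H * q) :
    H = mulDeriv ((logOf E.formalLogDivX).subst τ) -
      C a * (mulDeriv ((logOf E.formalLogDivX).subst τ)).subst (b - 1) := by
  set ℓ := mulDeriv ((logOf E.formalLogDivX).subst τ) with hℓ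
  set L : PowerSeries K := E.formalLogDivX.subst τ with hL
  have hs := hasSubst_sub_one hb0
  have hL0 : PowerSeries.constantCoeff L = 1 := by
    rw [hL, constantCoeff_subst_of_constantCoeff_zero h.constantCoeff, constantCoeff_formalLogDivX]
  have h1 : E.formalLog.subst τ = τ * L := by
    rw [← X_mul_formalLogDivX, subst_mul h.hasSubst, subst_X h.hasSubst]
  have h2 : mulDeriv L = ℓ * L := by
    rw [hℓ, h.mulDeriv_subst, hL, h.mulDeriv_subst, ← subst_mul h.hasSubst, invDeriv, invDeriv,
      mul_assoc, derivative_logOf_mul constantCoeff_formalLogDivX]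
  have hτ0 : C a * τ ≠ 0 := by
    refine mul_ne_zero (fun h0 => ha (C_injective (h0.trans (map_zero C).symm))) fun h0 => ?_
    have := h.coeff_one
    rw [h0, map_zero] at this
    exact zero_ne_one this
  -- `log_F ∘ [a] = a log_F`, divided by `a τ`
  have h3 : q * L.subst (b - 1) = L := by
    have h4 := formalLog_subst_subst h hb0 hb
    rw [h1, subst_mul hs, ← hq] at h4
    refine mul_left_cancel₀ hτ0 ?_
    linear_combination h4
  have h5 := congrArg mulDeriv h3
  rw [mulDeriv_mul, hH, mulDeriv_subst_sub_one hb0 hb, h2, subst_mul hs] at h5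
  have hL1 : L ≠ 0 := fun h0 => by
    rw [h0, map_zero] at hL0
    exact zero_ne_one hL0
  refine mul_right_cancel₀ hL1 ?_
  linear_combination h5 - (H + C a * ℓ.subst (b - 1)) * h3

/-- The moments of the measure with Mahler transform `H` in terms of `β^k(log(log_F(t) / t))`. -/
theorem constantCoeff_iterate_mulDeriv_logDeriv [Algebra ℚ K] {a : K} (ha : a ≠ 0)
    {b q H : PowerSeries K}
    (hb0 : PowerSeries.constantCoeff b = 1) (hb : mulDeriv b = C a * b)
    (hq : C a * τ * q = τ.subst (b - 1)) (hH : mulDeriv q = H * q) (k : ℕ) :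
    PowerSeries.constantCoeff (mulDeriv^[k] H) =
      E.beta (k + 1) (logOf E.formalLogDivX) * (1 - a ^ (k + 1)) := by
  rw [logDeriv_eq h ha hb0 hb hq hH, iterate_mulDeriv_sub, iterate_mulDeriv_C_mul,
    iterate_mulDeriv_subst_sub_one hb0 hb, ← h.constantCoeff_iterate_mulDeriv_subst, map_sub,
    map_mul, map_mul, constantCoeff_C, constantCoeff_C,
    constantCoeff_subst_of_constantCoeff_zero (by simp [hb0]), Function.iterate_succ_apply]
  ring

end Field

section Padic

variable {p : ℕ} [hp : Fact p.Prime] {F : FormalGroup ℤ_[p]}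

/-- The quotient of `[a](t)` by `a t`, in the coordinate of the multiplicative group. -/
theorem exists_subst_binomialSeries_eq {g τ : PowerSeries ℤ_[p]} (h : F.IsInverseParam g τ)
    (a : ℤ_[p]ˣ) : ∃ q H : PowerSeries ℤ_[p], PowerSeries.constantCoeff q = 1 ∧
      C (a : ℤ_[p]) * τ * q = τ.subst (binomialSeries ℤ_[p] (a : ℤ_[p]) - 1) ∧
      mulDeriv q = H * q := by
  have hB0 : PowerSeries.constantCoeff (binomialSeries ℤ_[p] (a : ℤ_[p])) = 1 :=
    binomialSeries_constantCoeff _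
  have hX : ∀ f : PowerSeries ℤ_[p], coeff 1 (X * f) = PowerSeries.constantCoeff f := fun f =>
    (coeff_succ_X_mul 0 f).trans (coeff_zero_eq_constantCoeff_apply f)
  obtain ⟨v, hv⟩ := X_dvd_iff.2 h.constantCoeff
  obtain ⟨w, hw⟩ := X_dvd_iff.2
    ((constantCoeff_subst_of_constantCoeff_zero (by simp [hB0]) τ).trans h.constantCoeff :
      PowerSeries.constantCoeff (τ.subst (binomialSeries ℤ_[p] (a : ℤ_[p]) - 1)) = 0)
  have hv0 : PowerSeries.constantCoeff v = 1 := by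
    have := h.coeff_one
    rwa [hv, hX] at this
  have hw0 : PowerSeries.constantCoeff w = a := by
    have h1 := constantCoeff_mulDeriv (τ.subst (binomialSeries ℤ_[p] (a : ℤ_[p]) - 1))
    rw [mulDeriv_subst_sub_one hB0 (mulDeriv_binomialSeries _), map_mul, constantCoeff_C,
      constantCoeff_subst_of_constantCoeff_zero (by simp [hB0]), constantCoeff_mulDeriv,
      h.coeff_one, mul_one, hw,
      hX] at h1
    exact h1.symm
  obtain ⟨v', hv'⟩ : ∃ v', v * v' = 1 :=
    (isUnit_iff_constantCoeff.2 (by simp [hv0])).exists_right_inv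
  have hv0' := congrArg PowerSeries.constantCoeff hv'
  rw [map_mul, hv0, one_mul, map_one] at hv0'
  have hq0 : PowerSeries.constantCoeff (C ((a⁻¹ : ℤ_[p]ˣ) : ℤ_[p]) * w * v') = 1 := by
    rw [map_mul, map_mul, hv0', hw0, constantCoeff_C, mul_one, Units.inv_mul]
  obtain ⟨q', hq'⟩ : ∃ q', C ((a⁻¹ : ℤ_[p]ˣ) : ℤ_[p]) * w * v' * q' = 1 :=
    (isUnit_iff_constantCoeff.2 (by simp [hq0])).exists_right_inv
  refine ⟨_, mulDeriv (C ((a⁻¹ : ℤ_[p]ˣ) : ℤ_[p]) * w * v') * q', hq0, ?_, ?_⟩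
  · have e : C (a : ℤ_[p]) * C ((a⁻¹ : ℤ_[p]ˣ) : ℤ_[p]) = 1 := by
      rw [← map_mul, Units.mul_inv, map_one]
    rw [hw]
    nth_rw 1 [hv]
    linear_combination X * w * v * v' * e + X * w * hv'
  · linear_combination -mulDeriv (C ((a⁻¹ : ℤ_[p]ˣ) : ℤ_[p]) * w * v') * hq'

/-- For a character `f` the eigenvalue equation `D_F f = β^1(f) f` can be iterated. -/
theorem beta_eq_pow_of_mem_dualTate {R : Type*} [CommRing R] {F : FormalGroup R} {f : PowerSeries R}
    (hf : f ∈ F.dualTate) (k : ℕ) : F.beta k f = F.beta 1 f ^ k := by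
  have h : F.invDeriv^[k] f = C (F.beta 1 f ^ k) * f := by
    induction k with
    | zero => simp
    | succ k ih =>
      rw [Function.iterate_succ_apply', ih, invDeriv_C_mul]
      nth_rw 1 [F.invDeriv_eq_of_mem_dualTate hf]
      rw [← mul_assoc, ← map_mul, pow_succ]
  rw [beta, h, map_mul, hf.1, constantCoeff_C, mul_one]

/-- The Bernoulli numbers `B^k(G, t)`, multiplied by the factors `1 - a ^ k` and `1 - p ^ (k - 1)`,
are the moments of a measure on `ℤ_p^×`. -/
theorem AndoCondition.exists_measure [F.IsComm] (hF : F.HasHeightOne) (hAndo : F.AndoCondition)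
    {g : PowerSeries ℤ_[p]} (hg0 : PowerSeries.constantCoeff g = 1) (hg : F.invDeriv g = g)
    (a : ℤ_[p]ˣ) : ∃ ν : AbstractMeasure ℤ_[p]ˣ ℤ_[p] ℤ_[p], ∀ k : ℕ, 1 ≤ k →
      ((ν (padicUnitPow p k) : ℤ_[p]) : ℚ_[p]) =
        F.bernoulliNumber k * (1 - ((a : ℤ_[p]) : ℚ_[p]) ^ k) * (1 - (p : ℚ_[p]) ^ (k - 1)) := by
  obtain ⟨τ, h⟩ := exists_isInverseParam hg0 hg
  obtain ⟨hcard, hprod⟩ := AndoCondition.prod_twist hF hAndo h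
  obtain ⟨q, H, hq0, hq, hH⟩ := exists_subst_binomialSeries_eq h a
  have hsum := PadicComplex.sum_twist_eq_of_prod_twist_eq hcard h.coeff_one hprod a hq0 hq hH
  refine ⟨unitsMeasure H, fun k hk => ?_⟩
  obtain ⟨k, rfl⟩ : ∃ j, k = j + 1 := ⟨k - 1, by omega⟩
  have hB0 : PowerSeries.constantCoeff (binomialSeries ℤ_[p] (a : ℤ_[p])) = 1 :=
    binomialSeries_constantCoeff _
  have hs := hasSubst_sub_one hB0
  set e := PadicInt.Coe.ringHom (p := p) with he
  have ha : e (a : ℤ_[p]) ≠ 0 := fun h0 => a.ne_zero (Subtype.coe_injective h0)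
  have hq' := congrArg (PowerSeries.map e) hq
  have hsub : PowerSeries.map e (τ.subst (binomialSeries ℤ_[p] (a : ℤ_[p]) - 1)) =
      (PowerSeries.map e τ).subst
        (PowerSeries.map e (binomialSeries ℤ_[p] (a : ℤ_[p])) - 1) := by
    have h1 := map_subst hs (h := e) τ
    refine h1.trans ?_
    congr 1
    exact (map_sub (PowerSeries.map e) _ _).trans (by rw [map_one])
  rw [hsub, map_mul, map_mul, PowerSeries.map_C] at hq'
  have key := constantCoeff_iterate_mulDeriv_logDeriv (h.map e) ha
    (b := PowerSeries.map e (binomialSeries ℤ_[p] (a : ℤ_[p])))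
    (by rw [PowerSeries.constantCoeff_map, hB0, map_one])
    (by rw [mulDeriv_map, mulDeriv_binomialSeries, map_mul, PowerSeries.map_C])
    hq' (H := PowerSeries.map e H) (by rw [mulDeriv_map, hH, map_mul]) k
  rw [iterate_mulDeriv_map, PowerSeries.constantCoeff_map] at key
  rw [unitsMeasure_padicUnitPow hcard hsum]
  refine (PadicInt.Coe.ringHom_apply (p := p) _).symm.trans ?_
  rw [← he, map_mul, key, map_sub, map_one, map_pow, map_natCast, Nat.add_sub_cancel]
  change _ = (F.map e).beta (k + 1) (logOf (F.map e).formalLogDivX) * (1 - e a ^ (k + 1)) * _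
  ring

end Padic

end FormalGroup

theorem mainTheorem8 (p : ℕ) [Fact p.Prime] (F : FormalGroup ℤ_[p]) [F.IsComm]
    (hF : F.HasHeightOne) (hAndo : F.AndoCondition) :
    ∃ (e : F.dualTate ≃ₜ ℤ_[p]) (u : F.dualTateUnits p ≃ₜ ℤ_[p]ˣ),
      (∀ g : F.dualTate, e g = F.beta 1 (g : PowerSeries ℤ_[p])) ∧
      (∀ g h : F.dualTate, e (g * h) = e g + e h) ∧
      (∀ g : F.dualTateUnits p, (u g : ℤ_[p]) = e (g : F.dualTate)) ∧
      ∀ a : ℤ_[p]ˣ, a ≠ 1 → a ≠ -1 →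
        ∃ μ : AbstractMeasure (F.dualTateUnits p) ℤ_[p] ℤ_[p], ∀ k : ℕ, 1 ≤ k →
          ((μ (F.pairing p k) : ℤ_[p]) : ℚ_[p]) =
              F.bernoulliNumber k * (1 - ((a : ℤ_[p]) : ℚ_[p]) ^ k) *
                (1 - (p : ℚ_[p]) ^ (k - 1)) ∧
          ((μ ((padicUnitPow p k).comp (u : C(F.dualTateUnits p, ℤ_[p]ˣ))) : ℤ_[p]) : ℚ_[p]) =
              F.bernoulliNumber k * (1 - ((a : ℤ_[p]) : ℚ_[p]) ^ k) *
                (1 - (p : ℚ_[p]) ^ (k - 1)) := by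
  obtain ⟨T, -, -, -, hpow⟩ := FormalGroup.AndoCondition.exists_finset hF hAndo
  obtain ⟨g, hg0, hg⟩ := FormalGroup.exists_invDeriv_eq_self hpow
  set u := FormalGroup.dualTateUnitsHomeomorph hg0 hg with hu
  refine ⟨FormalGroup.dualTateHomeomorph hg0 hg, u, fun _ => rfl, FormalGroup.beta_one_mul,
    FormalGroup.coe_dualTateUnitsHomeomorph hg0 hg, fun a _ _ => ?_⟩
  obtain ⟨ν, hν⟩ := FormalGroup.AndoCondition.exists_measure hF hAndo hg0 hg a
  have h1 : ∀ k, ((padicUnitPow p k).comp (u : C(F.dualTateUnits p, ℤ_[p]ˣ))).comp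
      (u.symm : C(ℤ_[p]ˣ, F.dualTateUnits p)) = padicUnitPow p k := by
    intro k
    ext x
    change padicUnitPow p k (u (u.symm x)) = _
    rw [u.apply_symm_apply]
  have h2 : ∀ k, F.pairing p k =
      (padicUnitPow p k).comp (u : C(F.dualTateUnits p, ℤ_[p]ˣ)) := by
    intro k
    ext f
    change F.beta k ((f : F.dualTate) : PowerSeries ℤ_[p]) = ((u f : ℤ_[p]ˣ) : ℤ_[p]) ^ k
    rw [FormalGroup.beta_eq_pow_of_mem_dualTate (f : F.dualTate).2, hu,
      FormalGroup.coe_dualTateUnitsHomeomorph]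
    rfl
  refine ⟨ν.map (u.symm : C(ℤ_[p]ˣ, F.dualTateUnits p)), fun k hk => ?_⟩
  rw [h2, AbstractMeasure.map_apply, h1]
  exact ⟨hν k hk, hν k hk⟩
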